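/- Let $\mathbb X$ be a non-empty Polish space with its Borel $\sigma$-algebra and let $\Phi=\sum_{j=1}^{N}\delta_{X_j}$ be a finite simple point process on $\mathbb X$ ($N<\infty$, and the points are a.s. pairwise distinct). Attach to its points marks $S_j$ that are i.i.d. with law $H$ on $\mathbb R_+$ and independent of $\Phi$; put $\tilde\mu=\sum_{j\le N} S_j\delta_{X_j}$, $T=\tilde\mu(\mathbb X)$ and $\tilde p=\tilde\mu/T$ (with $\tilde p=0$ if $T=0$, in which case no observation is generated). Given $\tilde\mu$, let $Y_1,Y_2,\dots$ be i.i.d. from $\tilde p$. For $k\ge 1$ let $M_{\Phi^k}$ be the $k$-th moment measure on $k$-tuples of different points, $M_{\Phi^k}(B)=\mathsf E\sum^{\neq}\mathbf 1_B(X_{j_1},\dots,X_{j_k})$. The $k$-th Palm distributions $\mathbf P_\Phi^{\boldsymbol x}$ are defined by $\mathsf E\sum^{\ne}\mathbf 1_B(X_{j_1},\dots,X_{j_k})\mathbf 1_L(\Phi)=\int_B \mathbf P_\Phi^{\boldsymbol x}(L)\,M_{\Phi^k}(d\boldsymbol x)$. Let $\Phi_{\boldsymbol x}\sim\mathbf P_\Phi^{\boldsymbol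 x}$, let $\Phi^!_{\boldsymbol x}=\Phi_{\boldsymbol x}-\sum_i\delta_{x_i}$ be its reduced version, and let $\tilde\mu^!_{\boldsymbol x}$ be the random measure obtained by marking $\Phi^!_{\boldsymbol x}$ with i.i.d. marks from $H$. Put $\kappa(u,m)=\int_{\mathbb R_+}e^{-us}s^m\,H(ds)$. Let $n\ge 1$ and write $\boldsymbol Y=(Y_1,\dots,Y_n)$. Consider the event that $\boldsymbol Y=\boldsymbol y$ has $k$ distinct values $\boldsymbol y^*=(y_1^*,\dots,y_k^*)$ with a given allocation of the $n$ observations to them and counts $n_1,\dots,n_k$. Assume that $M_{\Phi^k}$ and $M_{\Phi^{k+1}}$ are $\sigma$-finite and that $M_{\Phi^k}\ll P_0^k$, $M_{\Phi^{k+1}}\ll P_0^{k+1}$ for a non-atomic probability $P_0$, with densities $m_{\Phi^k}$, $m_{\Phi^{k+1}}$. For $u>0$ define the measure $$N_{u}(A)=\sum_{j=1}^k\frac{\kappa(u,n_j+1)}{\kappa(u,n_j)}\,\delta_{y_j^*}(A)+\int_A \kappa(u,1)\,\frac{\mathsf E\big[e^{-\int u\,\tilde\mu^!_{(\boldsymbol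 y^*,y)}(dz)}\big]}{\mathsf E\big[e^{-\int u\,\tilde\mu^!_{\boldsymbol y^*}(dz)}\big]}\,\frac{m_{\Phi^{k+1}}(\boldsymbol y^*,y)}{m_{\Phi^k}(\boldsymbol y^*)}\,P_0(dy)$$ and let $f_{U_n\mid\boldsymbol Y}$ be the probability density on $(0,\infty)$ with $$f_{U_n\mid \boldsymbol Y}(u)\propto u^{n-1}\,\mathsf E\big[e^{-\int u\,\tilde\mu^!_{\boldsymbol y^*}(dz)}\big]\prod_{j=1}^k\kappa(u,n_j).$$ Then, for almost every $\boldsymbol y$ (and, in 3 and 4, almost every value $u$ of $U$) under the law of the sample: 1. If $U_n$, given $\tilde\mu$ and $\boldsymbol Y$, has law $\mathrm{Gamma}(n,T)$, then $f_{U_n\mid\boldsymbol Y}$ is the density of the conditional law of $U_n$ given $\boldsymbol Y=\boldsymbol y$. Now let $U$ be an auxiliary variable which, given $\tilde\mu$ and $Y_1,\dots,Y_{n+1}$, has law $\mathrm{Gamma}(n+1,T)$. 2. $\displaystyle \mathsf P(Y_{n+1}\in A,\ U\in B\mid \boldsymbol Y=\boldsymbol y)=\int_{B\cap(0,\infty)}\frac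 un\,N_u(A)\,f_{U_n\mid\boldsymbol Y}(u)\,du$ for all Borel sets $A\subseteq\mathbb X$ and $B\subseteq\mathbb R$. 3. $0<N_u(\mathbb X)<\infty$ and $\mathsf P(Y_{n+1}\in\cdot\mid\boldsymbol Y=\boldsymbol y,\,U=u)=N_u(\cdot)/N_u(\mathbb X)$, i.e. the predictive distribution is proportional to $N_u$. 4. (Generalized Chinese restaurant process.) Given $\boldsymbol Y=\boldsymbol y$ and $U=u$, $Y_{n+1}$ equals the old value $y_j^*$ with probability $\frac{\kappa(u,n_j+1)}{\kappa(u,n_j)}/N_u(\mathbb X)$, $j=1,\dots,k$. Off the old values the predictive distribution is the second term of $N_u$ divided by $N_u(\mathbb X)$. -/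

import Mathlib

open MeasureTheory ProbabilityTheory
open scoped ENNReal NNReal

namespace NRM

noncomputable section

/-! ### Finite point processes -/

/-- An enumerated finite point configuration: `c.1` is the number of points and
`c.2 0, …, c.2 (c.1 - 1)` are the points (later entries of the sequence are ignored).
A finite point process `Φ` is given by a probability law on `Config E`. -/
abbrev Config (E : Type*) := ℕ × (ℕ → E)

/-- The counting measure `∑ δ_{X_i}` of a configuration. -/
def Config.toMeasure {E : Type*} [MeasurableSpace E] (c : Config E) : Measure E :=
  ∑ i ∈ Finset.range c.1, Measure.dirac (c.2 i)

/-- The points of the configuration are pairwise distinct. -/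
def Config.IsSimple {E : Type*} (c : Config E) : Prop :=
  Set.InjOn c.2 (Set.Iio c.1)

/-- The `k`-th Campbell measure on `k`-tuples of different points,
`C(B × L) = E[∑^{≠} 1_B(X_{j_1}, …, X_{j_k}) 1_L(Φ)]`. -/
def campbell {E : Type*} [MeasurableSpace E] (PΦ : Measure (Config E)) (k : ℕ)
    (B : Set (Fin k → E)) (L : Set (Measure E)) : ℝ≥0∞ :=
  ∫⁻ c, ∑ j : Fin k ↪ Fin c.1,
    B.indicator 1 (fun i => c.2 (j i)) * L.indicator 1 c.toMeasure ∂PΦ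

/-- The `k`-th (factorial) moment measure, i.e. the moment measure on `k`-tuples of different
points, `M(B) = E[∑^{≠} 1_B(X_{j_1}, …, X_{j_k})]`. -/
def momentMeasure {E : Type*} [MeasurableSpace E] (PΦ : Measure (Config E)) (k : ℕ) :
    Measure (Fin k → E) :=
  PΦ.bind fun c => ∑ j : Fin k ↪ Fin c.1, Measure.dirac fun i => c.2 (j i)

/-- `Q` is a version of the `k`-th reduced Palm distributions of the point process: the processes
`Φ_x := Φ^!_x + ∑ δ_{x_i}`, with `Φ^!_x` of law `Q x`, disintegrate the Campbell measure with
respect to the moment measure. -/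
def IsReducedPalm {E : Type*} [MeasurableSpace E] (PΦ : Measure (Config E)) (k : ℕ)
    (Q : Kernel (Fin k → E) (Config E)) : Prop :=
  ∀ (B : Set (Fin k → E)) (L : Set (Measure E)), MeasurableSet B → MeasurableSet L →
    campbell PΦ k B L =
      ∫⁻ x in B, Q x {c | c.toMeasure + ∑ i, Measure.dirac (x i) ∈ L} ∂(momentMeasure PΦ k)

/-! ### Marking and normalization -/

/-- The law of (configuration, marks): the marks are i.i.d. with law `H` and independent of the
configuration, whose law is `PΦ`; the `i`-th point carries the `i`-th mark. -/
def markedLaw {E : Type*} [MeasurableSpace E] (PΦ : Measure (Config E)) (H : Measure ℝ≥0) :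
    Measure (Config E × (ℕ → ℝ≥0)) :=
  PΦ.prod (Measure.infinitePi fun _ : ℕ => H)

/-- The random measure `μ̃ = ∑ S_i δ_{X_i}` of a marked configuration. -/
def randomMeasure {E : Type*} [MeasurableSpace E] (ω : Config E × (ℕ → ℝ≥0)) : Measure E :=
  ∑ i ∈ Finset.range ω.1.1, (ω.2 i : ℝ≥0∞) • Measure.dirac (ω.1.2 i)

/-- The normalized random measure `p̃ = μ̃ / μ̃(E)`, which is `0` when `μ̃(E) = 0`. -/
def normalized {E : Type*} [MeasurableSpace E] (ω : Config E × (ℕ → ℝ≥0)) : Measure E :=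
  (randomMeasure ω Set.univ)⁻¹ • randomMeasure ω

/-- The Laplace functional `E[exp(-∫ f dμ̃)]` of the random measure obtained by marking a point
process of law `PΦ` with i.i.d. marks of law `H`. -/
def laplace {E : Type*} [MeasurableSpace E] (PΦ : Measure (Config E)) (H : Measure ℝ≥0)
    (f : E → ℝ) : ℝ≥0∞ :=
  ∫⁻ ω, ENNReal.ofReal (Real.exp (-∫ z, f z ∂(randomMeasure ω))) ∂(markedLaw PΦ H)

/-- The joint law of `(Y_1, …, Y_m)` and `U`, where given `μ̃` the `Y_i` are i.i.d. from `p̃`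
and `U` is independent of them with law `Gamma(a, T)`, `T = μ̃(E)`. No observation is generated
when `T = 0`, so for `m ≥ 1` the total mass is `P(T > 0)`. -/
def sampleLaw {E : Type*} [MeasurableSpace E] (PΦ : Measure (Config E)) (H : Measure ℝ≥0)
    (m a : ℕ) : Measure ((Fin m → E) × ℝ) :=
  (markedLaw PΦ H).bind fun ω =>
    (Measure.pi fun _ : Fin m => normalized ω).prod
      (gammaMeasure a (randomMeasure ω Set.univ).toReal)

/-! ### The predictive weights -/

/-- `κ(u, m) = ∫ e^{-us} s^m H(ds)`. -/
def kappa (H : Measure ℝ≥0) (u : ℝ) (m : ℕ) : ℝ≥0∞ :=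
  ∫⁻ s, ENNReal.ofReal (Real.exp (-(u * s))) * (s : ℝ≥0∞) ^ m ∂H

/-- The number of observations sitting at table `j`. -/
def count {n k : ℕ} (σ : Fin n → Fin k) (j : Fin k) : ℕ :=
  (Finset.univ.filter fun i => σ i = j).card

/-- The density `m` of the `k`-th moment measure with respect to `P₀^k`. -/
def momentDensity {E : Type*} [MeasurableSpace E] (PΦ : Measure (Config E)) (P₀ : Measure E)
    (k : ℕ) : (Fin k → E) → ℝ≥0∞ :=
  (momentMeasure PΦ k).rnDeriv (Measure.pi fun _ => P₀)

/-- The weight `κ(u, n_j + 1) / κ(u, n_j)` of the `j`-th old value. -/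
def oldWeight {n k : ℕ} (H : Measure ℝ≥0) (σ : Fin n → Fin k) (u : ℝ) (j : Fin k) : ℝ≥0∞ :=
  kappa H u (count σ j + 1) / kappa H u (count σ j)

/-- The unnormalized law of a new value: it has density
`κ(u,1) · (E[e^{-∫ u dμ̃^!_{(y*,y)}}] / E[e^{-∫ u dμ̃^!_{y*}}]) · (m_{k+1}(y*,y) / m_k(y*))`
with respect to `P₀`. Here `Q`, `Q'` are the reduced Palm distributions of orders `k`, `k+1`. -/
def newPart {E : Type*} [MeasurableSpace E] {k : ℕ} (PΦ : Measure (Config E)) (H : Measure ℝ≥0)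
    (P₀ : Measure E) (Q : Kernel (Fin k → E) (Config E))
    (Q' : Kernel (Fin (k + 1) → E) (Config E)) (ystar : Fin k → E) (u : ℝ) : Measure E :=
  P₀.withDensity fun y =>
    kappa H u 1
      * (laplace (Q' (Fin.snoc (α := fun _ => E) ystar y)) H (fun _ => u)
          / laplace (Q ystar) H (fun _ => u))
      * (momentDensity PΦ P₀ (k + 1) (Fin.snoc (α := fun _ => E) ystar y)
          / momentDensity PΦ P₀ k ystar)

/-- The unnormalized predictive measure: old values plus new values. -/
def predictive {E : Type*} [MeasurableSpace E] {n k : ℕ} (PΦ : Measure (Config E))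
    (H : Measure ℝ≥0) (P₀ : Measure E) (Q : Kernel (Fin k → E) (Config E))
    (Q' : Kernel (Fin (k + 1) → E) (Config E)) (σ : Fin n → Fin k) (ystar : Fin k → E) (u : ℝ) :
    Measure E :=
  (∑ j, oldWeight H σ u j • Measure.dirac (ystar j)) + newPart PΦ H P₀ Q Q' ystar u

/-- The unnormalized density `u^{n-1} E[e^{-∫ u dμ̃^!_{y*}}] ∏_j κ(u, n_j)`, `u > 0`. -/
def latentWeight {E : Type*} [MeasurableSpace E] {n k : ℕ} (H : Measure ℝ≥0)
    (Q : Kernel (Fin k → E) (Config E)) (σ : Fin n → Fin k) (ystar : Fin k → E) (u : ℝ) : ℝ≥0∞ :=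
  (Set.Ioi (0 : ℝ)).indicator
    (fun u => ENNReal.ofReal (u ^ (n - 1)) * laplace (Q ystar) H (fun _ => u)
      * ∏ j, kappa H u (count σ j)) u

/-- The normalized density `f_{U_n | Y}`. -/
def latentDensity {E : Type*} [MeasurableSpace E] {n k : ℕ} (H : Measure ℝ≥0)
    (Q : Kernel (Fin k → E) (Config E)) (σ : Fin n → Fin k) (ystar : Fin k → E) (u : ℝ) : ℝ≥0∞ :=
  latentWeight H Q σ ystar u / ∫⁻ v, latentWeight H Q σ ystar v

/-! ### The laws above are finite measures -/

theorem randomMeasure_univ {E : Type*} [MeasurableSpace E] (ω : Config E × (ℕ → ℝ≥0)) :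
    randomMeasure ω Set.univ = ((∑ i ∈ Finset.range ω.1.1, ω.2 i : ℝ≥0) : ℝ≥0∞) := by
  simp [randomMeasure]

theorem normalized_univ_le {E : Type*} [MeasurableSpace E] (ω : Config E × (ℕ → ℝ≥0)) :
    normalized ω Set.univ ≤ 1 := by
  simp only [normalized, Measure.smul_apply, smul_eq_mul]
  exact ENNReal.inv_mul_le_one _

instance {E : Type*} [MeasurableSpace E] (ω : Config E × (ℕ → ℝ≥0)) :
    IsFiniteMeasure (normalized ω) :=
  ⟨(normalized_univ_le ω).trans_lt ENNReal.one_lt_top⟩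

theorem gammaMeasure_univ_le (a : ℕ) (r : ℝ) (hr : 0 ≤ r) : gammaMeasure a r Set.univ ≤ 1 := by
  rcases Nat.eq_zero_or_pos a with rfl | ha
  · have h : gammaPDF ((0 : ℕ) : ℝ) r = 0 := by
      funext x
      simp [gammaPDF, gammaPDFReal, Real.Gamma_zero]
    rw [gammaMeasure, h]; simp
  · rcases hr.eq_or_lt with rfl | hr
    · have h : gammaPDF (a : ℝ) 0 = 0 := by
        funext x
        simp [gammaPDF, gammaPDFReal, ha.ne']
      simp [gammaMeasure, h]
    · have := isProbabilityMeasure_gammaMeasure (a := a) (r := r) (by exact_mod_cast ha) hr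
      exact prob_le_one

instance {E : Type*} [MeasurableSpace E] (PΦ : Measure (Config E)) [IsProbabilityMeasure PΦ]
    (H : Measure ℝ≥0) [IsProbabilityMeasure H] : IsProbabilityMeasure (markedLaw PΦ H) := by
  unfold markedLaw; infer_instance

instance {E : Type*} [MeasurableSpace E] (PΦ : Measure (Config E)) [IsProbabilityMeasure PΦ]
    (H : Measure ℝ≥0) [IsProbabilityMeasure H] (m a : ℕ) :
    IsFiniteMeasure (sampleLaw PΦ H m a) := by
  by_cases hm : AEMeasurable (fun ω : Config E × (ℕ → ℝ≥0) =>
      (Measure.pi fun _ : Fin m => normalized ω).prod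
        (gammaMeasure a (randomMeasure ω Set.univ).toReal)) (markedLaw PΦ H)
  · refine ⟨lt_of_le_of_lt (b := 1) ?_ ENNReal.one_lt_top⟩
    rw [sampleLaw, Measure.bind_apply MeasurableSet.univ hm]
    calc _ ≤ ∫⁻ _, 1 ∂(markedLaw PΦ H) := lintegral_mono fun ω => ?_
      _ = 1 := by simp
    have : SFinite (gammaMeasure a (randomMeasure ω Set.univ).toReal) := by
      unfold gammaMeasure; infer_instance
    rw [← Set.univ_prod_univ, Measure.prod_prod, Measure.pi_univ]
    exact mul_le_one' (Finset.prod_le_one' fun _ _ => normalized_univ_le ω)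
      (gammaMeasure_univ_le _ _ ENNReal.toReal_nonneg)
  · have : sampleLaw PΦ H m a = 0 := by
      simp [sampleLaw, Measure.bind, Measure.map_of_not_aemeasurable hm]
    rw [this]; infer_instance

end

end NRM

namespace NRM

/-! ### Dependent finite sums and products of atomic measures -/

/-! The gamma variable removes the normalization. Its density is `T ^ n * u ^ (n-1) / Γ(n) *
e^{-uT}`, and `T ^ n` cancels the factor `T ^ (-n)` of the law of `n` draws from `p̃`. What remains,
`e^{-uT}` times a sum over index maps `f` of products of marks, factorizes over the points of the
configuration.

On the event that the ties follow `σ`, simplicity of the process reduces the index maps to `j ∘ σ`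
with `j` an injection (`sum_ite_pattern`). Integrating out the independent marks leaves `κ(u, n_l)`
for each chosen point and `κ(u, 0)` for each other point (`lintegral_marks`). The power `κ(u, 0) ^
(N - k)` depends only on the number of remaining points, so the Palm identity, tested on total
masses only, turns it into the Laplace functional of the marked reduced Palm process
(`laplace_const`, `lintegral_sum_embedding_mul`). Hence on this event the law of `(Y, U)` is
`Γ(n)⁻¹` times the image of `latentWeight x u du M_k(dx)` under `x ↦ x ∘ σ`
(`setLIntegral_sampleLaw_pattern`), and normalizing in `u` gives the law of `U_n`.

For prediction the same formula is used with `n + 1` observations. If the first `n` follow `σ`, the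
last one joins an old value or is new. The latent weight is then multiplied by `u` and by `κ(u, n_j
+ 1) / κ(u, n_j)`, or by `u`, `κ(u, 1)` and a ratio of Laplace functionals (`latentWeight_joinOld`,
`latentWeight_joinNew`). In the second case `M_{k+1}` is disintegrated over `M_k` with density
`m_{k+1} / m_k` (`lintegral_momentMeasure_succ`). The sum of all cases is integration against the
predictive measure, and `Γ(n+1) = n Γ(n)` produces the factor `u / n` (`setLIntegral_splitLast`).
The conditional laws are read off from these integral identities by uniqueness of disintegrations
(`condDistrib_ae_eq_on`). -/

theorem measurable_comp_nat {α β : Type*} [MeasurableSpace α] [MeasurableSpace β]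
    {N : α → ℕ} (hN : Measurable N) {g : ℕ → α → β} (hg : ∀ r, Measurable (g r)) :
    Measurable fun a => g (N a) a := by
  have : Measurable (fun p : ℕ × α => g p.1 p.2) :=
    measurable_from_prod_countable_right fun r => hg r
  exact this.comp (hN.prodMk measurable_id)

/-- On a box this is the distributive law: a product of sums over `ι` is a sum over choice functions
`κ → ι`. -/
theorem pi_sum_smul_dirac {E : Type*} [MeasurableSpace E] {ι κ : Type*} [Fintype ι] [Fintype κ]
    [DecidableEq κ] (a : ι → ℝ≥0) (x : ι → E) :
    (Measure.pi fun _ : κ => ∑ i, (a i : ℝ≥0∞) • Measure.dirac (x i))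
      = ∑ f : κ → ι, (∏ l, (a (f l) : ℝ≥0∞)) • Measure.dirac fun l => x (f l) := by
  classical
  have : IsFiniteMeasure (∑ i, (a i : ℝ≥0∞) • Measure.dirac (x i)) := by
    refine ⟨?_⟩
    simp [ENNReal.sum_lt_top]
  refine Measure.pi_eq fun s hs => ?_
  simp only [Measure.finsetSum_apply, Measure.smul_apply, smul_eq_mul]
  rw [Finset.prod_univ_sum]
  simp only [Fintype.piFinset_univ]
  refine Finset.sum_congr rfl fun f _ => ?_
  rw [Finset.prod_mul_distrib]
  congr 1
  rw [Measure.dirac_apply' _ (MeasurableSet.univ_pi hs)]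
  simp only [Measure.dirac_apply' _ (hs _), Set.indicator_apply, Pi.one_apply, Set.mem_univ_pi]
  rw [Finset.prod_ite_zero]
  simp

theorem randomMeasure_eq_sum {E : Type*} [MeasurableSpace E] (ω : Config E × (ℕ → ℝ≥0)) :
    randomMeasure ω = ∑ i : Fin ω.1.1, (ω.2 i : ℝ≥0∞) • Measure.dirac (ω.1.2 i) :=
  Finset.sum_range _

instance {E : Type*} [MeasurableSpace E] (ω : Config E × (ℕ → ℝ≥0)) :
    IsFiniteMeasure (randomMeasure ω) := by
  refine ⟨?_⟩
  rw [randomMeasure_univ]; exact ENNReal.coe_lt_top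

theorem lintegral_pi_randomMeasure {E : Type*} [MeasurableSpace E] (ω : Config E × (ℕ → ℝ≥0))
    {m : ℕ} {F : (Fin m → E) → ℝ≥0∞} (hF : Measurable F) :
    ∫⁻ y, F y ∂(Measure.pi fun _ : Fin m => randomMeasure ω)
      = ∑ f : Fin m → Fin ω.1.1,
          (∏ l, (ω.2 (f l) : ℝ≥0∞)) * F fun l => ω.1.2 (f l) := by
  rw [randomMeasure_eq_sum, pi_sum_smul_dirac (fun i : Fin ω.1.1 => ω.2 i)]
  simp only [lintegral_finsetSum_measure, lintegral_smul_measure, lintegral_dirac' _ hF,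
    smul_eq_mul]

/-- The total mass `T` of the random measure, as a nonnegative real. -/
def total {E : Type*} (ω : Config E × (ℕ → ℝ≥0)) : ℝ≥0 := ∑ i ∈ Finset.range ω.1.1, ω.2 i

/-- No case distinction on the total mass is needed. If it vanishes and `m ≥ 1`, the scalar is `∞`
but the measure it multiplies is zero. -/
theorem pi_normalized {E : Type*} [MeasurableSpace E] (ω : Config E × (ℕ → ℝ≥0)) (m : ℕ) :
    (Measure.pi fun _ : Fin m => normalized ω)
      = ((total ω : ℝ≥0∞)⁻¹ ^ m) • Measure.pi fun _ : Fin m => randomMeasure ω := by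
  have hn : normalized ω = (total ω : ℝ≥0∞)⁻¹ • randomMeasure ω := by
    rw [normalized, randomMeasure_univ]; rfl
  refine Measure.pi_eq fun s hs => ?_
  simp [hn, Finset.prod_mul_distrib, Measure.pi_pi]

theorem normalized_of_total_eq_zero {E : Type*} [MeasurableSpace E]
    {ω : Config E × (ℕ → ℝ≥0)} (hT : total ω = 0) : normalized ω = 0 := by
  have : randomMeasure ω = 0 := by
    rw [← Measure.measure_univ_eq_zero, randomMeasure_univ]
    exact_mod_cast hT
  simp [normalized, this]

theorem pi_normalized_of_total_eq_zero {E : Type*} [MeasurableSpace E]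
    {ω : Config E × (ℕ → ℝ≥0)} (hT : total ω = 0) {m : ℕ} (hm : 1 ≤ m) :
    (Measure.pi fun _ : Fin m => normalized ω) = 0 := by
  rw [← Measure.measure_univ_eq_zero, Measure.pi_univ, normalized_of_total_eq_zero hT]
  simp [Nat.pos_iff_ne_zero.1 hm]

/-- The factor `u^{n-1} / Γ(n)` of the gamma density. -/
noncomputable def gammaFactor (n : ℕ) (u : ℝ) : ℝ≥0∞ := ENNReal.ofReal (u ^ (n - 1) / Real.Gamma n)

@[fun_prop]
theorem measurable_gammaFactor (n : ℕ) : Measurable (gammaFactor n) := by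
  unfold gammaFactor; fun_prop

theorem gammaPDF_eq_factor {n : ℕ} (hn : 1 ≤ n) {r : ℝ≥0} {u : ℝ} (hu : 0 < u) :
    gammaPDF n r u = (r : ℝ≥0∞) ^ n * (gammaFactor n u * ENNReal.ofReal (Real.exp (-(u * r)))) := by
  have hG : 0 < Real.Gamma n := Real.Gamma_pos_of_pos (by exact_mod_cast hn)
  rw [gammaPDF_of_nonneg hu.le, gammaFactor, ← ENNReal.ofReal_mul (by positivity),
    ← ENNReal.ofReal_coe_nnreal, ← ENNReal.ofReal_pow (by positivity),
    ← ENNReal.ofReal_mul (by positivity)]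
  congr 1
  have h1 : u ^ ((n : ℝ) - 1) = u ^ (n - 1) := by
    rw [← Real.rpow_natCast, Nat.cast_sub hn, Nat.cast_one]
  rw [h1, Real.rpow_natCast, mul_comm u (r : ℝ)]
  ring

theorem lintegral_gammaMeasure {n : ℕ} (hn : 1 ≤ n) (r : ℝ≥0) {F : ℝ → ℝ≥0∞}
    (hF : Measurable F) :
    ∫⁻ u, F u ∂(gammaMeasure n r)
      = (r : ℝ≥0∞) ^ n * ∫⁻ u in Set.Ioi 0,
          gammaFactor n u * ENNReal.ofReal (Real.exp (-(u * r))) * F u := by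
  have hm : Measurable (gammaPDF n r) := (measurable_gammaPDFReal n r).ennreal_ofReal
  rw [gammaMeasure, lintegral_withDensity_eq_lintegral_mul _ hm hF,
    ← lintegral_const_mul _ (by fun_prop), ← lintegral_indicator measurableSet_Ioi]
  refine lintegral_congr_ae ?_
  filter_upwards [Measure.ae_ne volume (0 : ℝ)] with u hu
  rcases lt_or_gt_of_ne hu with h | h
  · simp [gammaPDF_of_neg h, h.le]
  · rw [Set.indicator_of_mem (Set.mem_Ioi.2 h), Pi.mul_apply, gammaPDF_eq_factor hn h]
    ring

/-- The function whose integral over `u` against the mark and configuration law gives the law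
of the sample: `u^{n-1}/Γ(n) e^{-uT} ∑_f ∏_l S_{f l} F(X_{f 1}, …, X_{f n}, u)`. -/
noncomputable def sampleIntegrand {E : Type*} {n : ℕ} (F : (Fin n → E) × ℝ → ℝ≥0∞)
    (ω : Config E × (ℕ → ℝ≥0)) (u : ℝ) : ℝ≥0∞ :=
  gammaFactor n u * ENNReal.ofReal (Real.exp (-(u * total ω)))
    * ∑ f : Fin n → Fin ω.1.1, (∏ l, (ω.2 (f l) : ℝ≥0∞)) * F (fun l => ω.1.2 (f l), u)

@[fun_prop]
theorem measurable_total {E : Type*} [MeasurableSpace E] :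
    Measurable (total : Config E × (ℕ → ℝ≥0) → ℝ≥0) :=
  measurable_comp_nat (N := fun ω : Config E × (ℕ → ℝ≥0) => ω.1.1)
    (g := fun r ω => ∑ i ∈ Finset.range r, ω.2 i) (by fun_prop) fun r => by fun_prop

theorem measurable_sampleIntegrand {E : Type*} [MeasurableSpace E] {n : ℕ}
    {F : (Fin n → E) × ℝ → ℝ≥0∞} (hF : Measurable F) :
    Measurable fun p : (Config E × (ℕ → ℝ≥0)) × ℝ => sampleIntegrand F p.1 p.2 := by
  unfold sampleIntegrand
  refine Measurable.mul (by fun_prop) ?_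
  -- The index type of the sum depends on the sample point. It becomes a fixed finite type once the
  -- number of points is fixed, and the countably many cases are glued together.
  refine measurable_comp_nat (N := fun p : (Config E × (ℕ → ℝ≥0)) × ℝ => p.1.1.1)
    (g := fun r p => ∑ f : Fin n → Fin r, (∏ l, (p.1.2 (f l) : ℝ≥0∞))
      * F (fun l => p.1.1.2 (f l), p.2)) (by fun_prop) fun r => ?_
  fun_prop

/-- This is where the shape of the gamma law matters: being equal to the number of observations, it
supplies exactly the power of the total mass that cancels the normalization. -/
theorem lintegral_pi_normalized_prod_gammaMeasure {E : Type*} [MeasurableSpace E] {n : ℕ}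
    (hn : 1 ≤ n) (ω : Config E × (ℕ → ℝ≥0)) {F : (Fin n → E) × ℝ → ℝ≥0∞} (hF : Measurable F) :
    ∫⁻ p, F p ∂((Measure.pi fun _ : Fin n => normalized ω).prod
        (gammaMeasure n (randomMeasure ω Set.univ).toReal))
      = ∫⁻ u in Set.Ioi 0, sampleIntegrand F ω u := by
  have hT : (randomMeasure ω Set.univ).toReal = (total ω : ℝ) := by
    rw [randomMeasure_univ]; rfl
  have : SFinite (gammaMeasure n (total ω : ℝ)) := by unfold gammaMeasure; infer_instance
  rw [hT, lintegral_prod_symm _ hF.aemeasurable,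
    lintegral_gammaMeasure hn _ hF.lintegral_prod_left',
    ← lintegral_const_mul _ (by fun_prop)]
  refine lintegral_congr fun u => ?_
  have hFu : Measurable fun y => F (y, u) := by fun_prop
  rw [pi_normalized, lintegral_smul_measure, lintegral_pi_randomMeasure ω hFu, sampleIntegrand,
    smul_eq_mul]
  rcases eq_or_ne (total ω) 0 with h | h
  -- With zero total mass all marks vanish, and `n ≥ 1` makes every product of marks on the right
  -- zero too.
  · have hs : ∀ i : Fin ω.1.1, ω.2 i = 0 := fun i =>
      Finset.sum_eq_zero_iff.1 h _ (Finset.mem_range.2 i.2)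
    simp [hs, h, Nat.pos_iff_ne_zero.1 hn]
  · have hc : (total ω : ℝ≥0∞) ^ n * (total ω : ℝ≥0∞)⁻¹ ^ n = 1 := by
      rw [← mul_pow, ENNReal.mul_inv_cancel (by exact_mod_cast h) ENNReal.coe_ne_top, one_pow]
    conv_rhs => rw [← one_mul (gammaFactor n u * _ * _), ← hc]
    ring

theorem measurable_sampleKernel {E : Type*} [MeasurableSpace E] {n : ℕ} (hn : 1 ≤ n) :
    Measurable fun ω : Config E × (ℕ → ℝ≥0) =>
      (Measure.pi fun _ : Fin n => normalized ω).prod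
        (gammaMeasure n (randomMeasure ω Set.univ).toReal) := by
  refine Measure.measurable_of_measurable_coe _ fun s hs => ?_
  have hF : Measurable (s.indicator (1 : (Fin n → E) × ℝ → ℝ≥0∞)) := measurable_one.indicator hs
  simp only [← lintegral_indicator_one hs, lintegral_pi_normalized_prod_gammaMeasure hn _ hF]
  exact (measurable_sampleIntegrand hF).lintegral_prod_right'

theorem lintegral_sampleLaw {E : Type*} [MeasurableSpace E] (PΦ : Measure (Config E))
    (H : Measure ℝ≥0) {n : ℕ} (hn : 1 ≤ n) {F : (Fin n → E) × ℝ → ℝ≥0∞} (hF : Measurable F) :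
    ∫⁻ p, F p ∂(sampleLaw PΦ H n n)
      = ∫⁻ ω, (∫⁻ u in Set.Ioi 0, sampleIntegrand F ω u) ∂(markedLaw PΦ H) := by
  rw [sampleLaw, Measure.lintegral_bind (measurable_sampleKernel hn).aemeasurable
    hF.aemeasurable]
  simp only [lintegral_pi_normalized_prod_gammaMeasure hn _ hF]

/-! ### Integration over the marks -/

@[fun_prop]
theorem measurable_kappa (H : Measure ℝ≥0) [SFinite H] (m : ℕ) :
    Measurable fun u => kappa H u m := by
  unfold kappa
  exact Measurable.lintegral_prod_right' (f := fun p : ℝ × ℝ≥0 =>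
    ENNReal.ofReal (Real.exp (-(p.1 * p.2))) * (p.2 : ℝ≥0∞) ^ m) (by fun_prop)

theorem ofReal_exp_total {E : Type*} (ω : Config E × (ℕ → ℝ≥0)) (u : ℝ) :
    ENNReal.ofReal (Real.exp (-(u * total ω)))
      = ∏ i : Fin ω.1.1, ENNReal.ofReal (Real.exp (-(u * ω.2 i))) := by
  rw [← ENNReal.ofReal_prod_of_nonneg fun _ _ => (Real.exp_pos _).le, ← Real.exp_sum,
    Finset.sum_neg_distrib, ← Finset.mul_sum, total, NNReal.coe_sum,
    Finset.sum_range (fun i => ((ω.2 i : ℝ≥0) : ℝ))]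

theorem lintegral_prod_marks (H : Measure ℝ≥0) [IsProbabilityMeasure H] {N : ℕ} (g : Fin N → ℕ)
    (u : ℝ) :
    ∫⁻ s : ℕ → ℝ≥0, ∏ i : Fin N, (ENNReal.ofReal (Real.exp (-(u * s i))) * (s i : ℝ≥0∞) ^ g i)
        ∂(Measure.infinitePi fun _ => H)
      = ∏ i, kappa H u (g i) := by
  have hind : iIndepFun (fun (i : ℕ) (s : ℕ → ℝ≥0) => s i) (Measure.infinitePi fun _ : ℕ => H) :=
    iIndepFun_infinitePi (X := fun _ => id) fun _ => measurable_id
  have hind' : iIndepFun (fun (i : Fin N) (s : ℕ → ℝ≥0) =>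
      ENNReal.ofReal (Real.exp (-(u * s i))) * (s i : ℝ≥0∞) ^ g i)
      (Measure.infinitePi fun _ : ℕ => H) :=
    (hind.precomp Fin.val_injective).comp
      (fun i (x : ℝ≥0) => ENNReal.ofReal (Real.exp (-(u * x))) * (x : ℝ≥0∞) ^ g i)
      fun i => by fun_prop
  rw [lintegral_prod_eq_prod_lintegral_of_indepFun _ _ hind' fun i => by fun_prop]
  refine Finset.prod_congr rfl fun i _ => ?_
  exact (measurePreserving_eval_infinitePi (fun _ : ℕ => H) i).lintegral_comp
    (f := fun s : ℝ≥0 => ENNReal.ofReal (Real.exp (-(u * s))) * (s : ℝ≥0∞) ^ g i) (by fun_prop)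

/-- Giving the exponent `0` to the points outside the tuple lets a product over the `k` chosen
points be handled as a product over all points. -/
theorem prod_extend_zero {M : Type*} [CommMonoid M] {k N : ℕ} (j : Fin k ↪ Fin N)
    (e : Fin k → ℕ) (φ : Fin N → ℕ → M) :
    ∏ i, φ i (Function.extend j e 0 i)
      = (∏ l, φ (j l) (e l)) * ∏ i ∈ (Finset.univ.map j)ᶜ, φ i 0 := by
  rw [← Finset.prod_mul_prod_compl (Finset.univ.map j), Finset.prod_map]
  congr 1
  · simp [j.injective.extend_apply]
  · refine Finset.prod_congr rfl fun i hi => ?_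
    rw [Function.extend_apply' _ _ _ (by simpa using hi)]
    rfl

/-- The exponential of the total mass splits over the points, so by independence each chosen point
contributes its own moment and each of the `c.1 - k` others contributes `κ(u, 0)`. -/
theorem lintegral_marks (H : Measure ℝ≥0) [IsProbabilityMeasure H] {E : Type*} (c : Config E)
    {k : ℕ} (j : Fin k ↪ Fin c.1) (e : Fin k → ℕ) (u : ℝ) :
    ∫⁻ s : ℕ → ℝ≥0, ENNReal.ofReal (Real.exp (-(u * total (c, s))))
        * ∏ l, (s (j l) : ℝ≥0∞) ^ e l ∂(Measure.infinitePi fun _ => H)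
      = (∏ l, kappa H u (e l)) * kappa H u 0 ^ (c.1 - k) := by
  have h2 := prod_extend_zero j e fun _ m => kappa H u m
  rw [Finset.prod_const, Finset.card_compl, Finset.card_map, Finset.card_univ, Fintype.card_fin,
    Fintype.card_fin] at h2
  rw [← h2, ← lintegral_prod_marks]
  refine lintegral_congr fun s => ?_
  have h1 := prod_extend_zero j e fun i m => (s i : ℝ≥0∞) ^ m
  simp only [pow_zero, Finset.prod_const_one, mul_one] at h1
  rw [Finset.prod_mul_distrib, h1, ofReal_exp_total]

/-- A constant test function sees only the total mass, so the Laplace functional is the generating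
function of the number of points at `κ(u, 0)`. The locations of the Palm process therefore play no
role. -/
theorem laplace_const {E : Type*} [MeasurableSpace E] (P : Measure (Config E)) [SFinite P]
    (H : Measure ℝ≥0) [IsProbabilityMeasure H] (u : ℝ) :
    laplace P H (fun _ => u) = ∫⁻ c, kappa H u 0 ^ c.1 ∂P := by
  have h : ∀ ω : Config E × (ℕ → ℝ≥0),
      ∫ _, u ∂(randomMeasure ω) = u * total ω := fun ω => by
    rw [integral_const, measureReal_def, randomMeasure_univ, smul_eq_mul, mul_comm]; rfl
  simp only [laplace, h, markedLaw]
  rw [lintegral_prod _ (by fun_prop)]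
  refine lintegral_congr fun c => ?_
  -- With the empty tuple every point is unchosen and contributes `κ(u, 0)`.
  have := lintegral_marks H c (k := 0) ⟨Fin.elim0, fun i => i.elim0⟩ Fin.elim0 u
  simpa using this

theorem measurable_laplace {E α : Type*} [MeasurableSpace E] [MeasurableSpace α]
    (Q : Kernel α (Config E)) [IsSFiniteKernel Q] (H : Measure ℝ≥0) [IsProbabilityMeasure H] :
    Measurable fun p : α × ℝ => laplace (Q p.1) H (fun _ => p.2) := by
  simp only [laplace_const]
  have : Measurable fun p : (α × ℝ) × Config E => kappa H p.1.2 0 ^ p.2.1 := by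
    refine measurable_comp_nat (N := fun p : (α × ℝ) × Config E => p.2.1)
      (g := fun r p => kappa H p.1.2 0 ^ r) (by fun_prop) fun r => ?_
    have := measurable_kappa H 0
    fun_prop
  exact this.lintegral_kernel_prod_right' (κ := Q.comap Prod.fst measurable_fst)

/-! ### The Campbell formula for the number of points -/

theorem measurable_sum_dirac {E : Type*} [MeasurableSpace E] (k : ℕ) :
    Measurable fun c : Config E =>
      ∑ j : Fin k ↪ Fin c.1, Measure.dirac fun i => c.2 (j i) := by
  refine measurable_comp_nat (N := fun c : Config E => c.1)
    (g := fun r c => ∑ j : Fin k ↪ Fin r, Measure.dirac fun i => c.2 (j i)) (by fun_prop)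
    fun r => ?_
  refine Finset.measurable_fun_sum _ fun j _ => ?_
  exact Measure.measurable_dirac.comp (by fun_prop)

theorem lintegral_momentMeasure {E : Type*} [MeasurableSpace E] (PΦ : Measure (Config E)) (k : ℕ)
    {f : (Fin k → E) → ℝ≥0∞} (hf : Measurable f) :
    ∫⁻ x, f x ∂(momentMeasure PΦ k)
      = ∫⁻ c, ∑ j : Fin k ↪ Fin c.1, f (fun i => c.2 (j i)) ∂PΦ := by
  rw [momentMeasure, Measure.lintegral_bind (measurable_sum_dirac k).aemeasurable hf.aemeasurable]
  simp only [lintegral_finsetSum_measure, lintegral_dirac' _ hf]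

theorem Config.toMeasure_univ {E : Type*} [MeasurableSpace E] (c : Config E) :
    c.toMeasure Set.univ = c.1 := by
  simp [Config.toMeasure]

@[fun_prop]
theorem measurable_sum_embedding {E : Type*} [MeasurableSpace E] {k : ℕ}
    {f : (Fin k → E) → ℝ≥0∞} (hf : Measurable f) :
    Measurable fun c : Config E => ∑ j : Fin k ↪ Fin c.1, f (fun i => c.2 (j i)) :=
  measurable_comp_nat (N := fun c : Config E => c.1)
    (g := fun r c => ∑ j : Fin k ↪ Fin r, f (fun i => c.2 (j i))) (by fun_prop)
    fun r => by fun_prop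

theorem measurableSet_card {E : Type*} [MeasurableSpace E] (r : ℕ) :
    MeasurableSet {c : Config E | c.1 = r} :=
  measurable_fst (measurableSet_singleton r)

/-- The Palm identity is tested against the event that the total mass is `r + k`. Adding the `k`
Dirac masses to the reduced process shifts its number of points by `k`, so the event becomes `c.1 =
r`. -/
theorem momentMeasure_restrict_card {E : Type*} [MeasurableSpace E] {PΦ : Measure (Config E)}
    {k : ℕ} {Q : Kernel (Fin k → E) (Config E)} (hQ : IsReducedPalm PΦ k Q) (r : ℕ) :
    momentMeasure (PΦ.restrict {c | c.1 = r + k}) k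
      = (momentMeasure PΦ k).withDensity fun x => Q x {c | c.1 = r} := by
  ext B hB
  have hL : MeasurableSet {μ : Measure E | μ Set.univ = ((r + k : ℕ) : ℝ≥0∞)} :=
    Measure.measurable_coe MeasurableSet.univ (measurableSet_singleton _)
  have hset : ∀ x : Fin k → E, {c : Config E | c.toMeasure + ∑ i, Measure.dirac (x i)
      ∈ {μ : Measure E | μ Set.univ = ((r + k : ℕ) : ℝ≥0∞)}} = {c | c.1 = r} := fun x => by
    ext c
    simp only [Set.mem_ofPred_eq, Measure.add_apply, Config.toMeasure_univ,
      Measure.finsetSum_apply, measure_univ, Finset.sum_const, Finset.card_univ,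
      Fintype.card_fin, nsmul_eq_mul, mul_one]
    norm_cast
    omega
  have h := hQ B _ hB hL
  simp only [hset] at h
  rw [withDensity_apply _ hB, ← h, ← lintegral_indicator_one hB,
    lintegral_momentMeasure _ _ (measurable_one.indicator hB),
    ← lintegral_indicator (measurableSet_card _), campbell]
  refine lintegral_congr fun c => ?_
  simp only [Set.indicator_apply, Set.mem_ofPred_eq, Config.toMeasure_univ, Nat.cast_inj]
  split_ifs <;> simp

/-- The Campbell formula for functions of the tuple and of the number of remaining points, obtained
by splitting according to that number. -/
theorem lintegral_sum_embedding_mul {E : Type*} [MeasurableSpace E] {PΦ : Measure (Config E)}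
    {k : ℕ} {Q : Kernel (Fin k → E) (Config E)} (hQ : IsReducedPalm PΦ k Q)
    {f : (Fin k → E) → ℝ≥0∞} (hf : Measurable f) (G : ℕ → ℝ≥0∞) :
    ∫⁻ c, (∑ j : Fin k ↪ Fin c.1, f (fun i => c.2 (j i))) * G (c.1 - k) ∂PΦ
      = ∫⁻ x, f x * ∫⁻ c, G c.1 ∂(Q x) ∂(momentMeasure PΦ k) := by
  have hG : ∀ x, ∫⁻ c, G c.1 ∂(Q x) = ∑' r, G r * Q x {c | c.1 = r} := fun x => by
    have : ∀ c : Config E, G c.1 = ∑' r, {c : Config E | c.1 = r}.indicator (fun _ => G r) c :=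
      fun c => by
        rw [tsum_eq_single c.1 fun r hr => by simp [hr.symm]]
        simp
    rw [lintegral_congr this,
      lintegral_tsum fun r => (measurable_const.indicator (measurableSet_card r)).aemeasurable]
    exact tsum_congr fun r => lintegral_indicator_const (measurableSet_card r) _
  have hQm : ∀ r, Measurable fun x => Q x {c | c.1 = r} := fun r =>
    Q.measurable_coe (measurableSet_card r)
  have hleft : ∀ c : Config E,
      (∑ j : Fin k ↪ Fin c.1, f (fun i => c.2 (j i))) * G (c.1 - k)
        = ∑' r, G r * {c : Config E | c.1 = r + k}.indicator
            (fun c => ∑ j : Fin k ↪ Fin c.1, f (fun i => c.2 (j i))) c := fun c => by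
    -- With fewer than `k` points the truncated difference `c.1 - k` is `0`, which is harmless
    -- because there are no injections to sum over.
    rcases lt_or_ge c.1 k with h | h
    · have : IsEmpty (Fin k ↪ Fin c.1) := ⟨fun j => by
        have := Fintype.card_le_of_embedding j
        simp at this; omega⟩
      simp [Set.indicator_apply]
    · rw [tsum_eq_single (c.1 - k) fun r hr => ?_]
      · rw [Set.indicator_of_mem (by simp [h]), mul_comm]
      · rw [Set.indicator_of_notMem (by simp; omega), mul_zero]
  have hm := measurable_sum_embedding hf
  simp only [hG, hleft, ← ENNReal.tsum_mul_left]
  rw [lintegral_tsum fun r =>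
      ((hm.indicator (measurableSet_card _)).const_mul _).aemeasurable,
    lintegral_tsum fun r =>
      (show Measurable fun x => f x * (G r * Q x {c | c.1 = r}) from
        hf.mul ((hQm r).const_mul _)).aemeasurable]
  refine tsum_congr fun r => ?_
  rw [lintegral_const_mul _ (hm.indicator (measurableSet_card _)),
    lintegral_indicator (measurableSet_card _), ← lintegral_momentMeasure _ _ hf,
    momentMeasure_restrict_card hQ, lintegral_withDensity_eq_lintegral_mul _ (hQm r) hf,
    ← lintegral_const_mul _ ((hQm r).mul hf)]
  refine lintegral_congr fun x => ?_
  simp only [Pi.mul_apply]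
  ring

/-! ### The law of the sample on a pattern of ties -/

/-- The samples whose pattern of ties is given by the allocation `σ` to distinct values. -/
def pattern (E : Type*) {n k : ℕ} (σ : Fin n → Fin k) : Set (Fin n → E) :=
  {y | ∃ x : Fin k → E, Function.Injective x ∧ y = x ∘ σ}

theorem comp_mem_pattern {E : Type*} {n k : ℕ} {σ : Fin n → Fin k} {x : Fin k → E}
    (hx : Function.Injective x) : x ∘ σ ∈ pattern E σ := ⟨x, hx, rfl⟩

theorem measurableSet_injective {E ι : Type*} [Countable ι] [MeasurableSpace E] [MeasurableEq E] :
    MeasurableSet {x : ι → E | Function.Injective x} := by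
  have : {x : ι → E | Function.Injective x} = ⋂ i, ⋂ j, ⋂ (_ : i ≠ j), {x | x i = x j}ᶜ := by
    ext x
    simp only [Function.Injective, Set.mem_ofPred_eq, Set.mem_iInter, Set.mem_compl_iff]
    exact ⟨fun h i j hij e => hij (h e), fun h i j e => by_contra fun hij => h i j hij e⟩
  rw [this]
  exact MeasurableSet.iInter fun i => .iInter fun j => .iInter fun _ =>
    (measurableSet_eq_fun (measurable_pi_apply i) (measurable_pi_apply j)).compl

/-- A section `s` of `σ` recovers the distinct values as `y ∘ s`. This replaces the existential by
finitely many equalities and the injectivity of `y ∘ s`. -/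
theorem measurableSet_pattern {E : Type*} [MeasurableSpace E] [MeasurableEq E] {n k : ℕ}
    {σ : Fin n → Fin k} (hσ : Function.Surjective σ) : MeasurableSet (pattern E σ) := by
  obtain ⟨s, hs⟩ := hσ.hasRightInverse
  have : pattern E σ = (⋂ i, {y | y i = y (s (σ i))}) ∩
      (fun y : Fin n → E => y ∘ s) ⁻¹' {x | Function.Injective x} := by
    ext y
    simp only [Set.mem_inter_iff, Set.mem_iInter, Set.mem_ofPred_eq, Set.mem_preimage]
    constructor
    · rintro ⟨x, hx, rfl⟩
      have : (x ∘ σ) ∘ s = x := by ext l; simp [hs l]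
      exact ⟨fun i => by simp [hs (σ i)], by rwa [this]⟩
    · rintro ⟨h1, h2⟩
      exact ⟨y ∘ s, h2, funext h1⟩
  rw [this]
  refine (MeasurableSet.iInter fun i => ?_).inter ?_
  · exact measurableSet_eq_fun (measurable_pi_apply _) (measurable_pi_apply _)
  · exact (measurable_pi_lambda _ fun l => measurable_pi_apply (s l)) measurableSet_injective

-- As the points are distinct, two draws coincide exactly when their indices do. The index maps
-- realizing the ties of `σ` are thus the `j ∘ σ` with `j` injective, and `j` is unique because `σ`
-- is onto.
open Classical in
theorem sum_ite_pattern {E : Type*} {n k N : ℕ} {σ : Fin n → Fin k} (hσ : Function.Surjective σ)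
    {X : ℕ → E} (hX : Set.InjOn X (Set.Iio N)) (φ : (Fin n → Fin N) → ℝ≥0∞) :
    ∑ f : Fin n → Fin N, (if (fun i => X (f i)) ∈ pattern E σ then φ f else 0)
      = ∑ j : Fin k ↪ Fin N, φ (j ∘ σ) := by
  have hX' : Function.Injective fun i : Fin N => X i := fun a b h =>
    Fin.ext (hX a.2 b.2 h)
  rw [← Finset.sum_filter]
  symm
  refine Finset.sum_nbij (fun j => j ∘ σ) ?_ ?_ ?_ fun _ _ => rfl
  · intro j _
    simp only [Finset.mem_filter, Finset.mem_univ, true_and]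
    exact comp_mem_pattern (x := fun l => X (j l)) (hX'.comp j.injective)
  · intro j _ j' _ h
    ext l
    obtain ⟨i, rfl⟩ := hσ l
    exact congrArg Fin.val (congrFun h i)
  · intro f hf
    simp only [Finset.coe_filter, Finset.mem_univ, true_and, Set.mem_ofPred_eq] at hf
    obtain ⟨x, hx, hfx⟩ := hf
    obtain ⟨s, hs⟩ := hσ.hasRightInverse
    have hxs : ∀ l, X (f (s l)) = x l := fun l => by
      have := congrFun hfx (s l)
      simpa [hs l] using this
    refine ⟨⟨f ∘ s, fun a b h => hx ?_⟩, by simp, ?_⟩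
    · rw [← hxs a, ← hxs b]
      exact congrArg (fun i : Fin N => X i) h
    · ext i
      have h1 := congrFun hfx i
      have h2 := hxs (σ i)
      exact congrArg Fin.val (hX' (h2.trans h1.symm))

theorem prod_comp_eq_prod_pow_count {M : Type*} [CommMonoid M] {n k : ℕ} (σ : Fin n → Fin k)
    (g : Fin k → M) : ∏ i, g (σ i) = ∏ l, g l ^ count σ l := by
  simp only [count]
  rw [← Finset.prod_fiberwise' Finset.univ σ g]
  simp

theorem sampleIntegrand_pattern {E : Type*} {n k : ℕ} {σ : Fin n → Fin k}
    (hσ : Function.Surjective σ) {c : Config E} (hc : c.IsSimple) (s : ℕ → ℝ≥0)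
    (F : (Fin n → E) × ℝ → ℝ≥0∞) (u : ℝ) :
    sampleIntegrand ((Prod.fst ⁻¹' pattern E σ).indicator F) (c, s) u
      = gammaFactor n u * ∑ j : Fin k ↪ Fin c.1, F ((fun l => c.2 (j l)) ∘ σ, u)
          * (ENNReal.ofReal (Real.exp (-(u * total (c, s))))
              * ∏ l, (s (j l) : ℝ≥0∞) ^ count σ l) := by
  classical
  have h := sum_ite_pattern hσ hc fun f : Fin n → Fin c.1 =>
    (∏ l, (s (f l) : ℝ≥0∞)) * F (fun l => c.2 (f l), u)
  simp only [sampleIntegrand, Set.indicator_apply, Set.mem_preimage, mul_ite, mul_zero]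
  rw [h, mul_assoc, Finset.mul_sum]
  congr 1
  refine Finset.sum_congr rfl fun j _ => ?_
  rw [← prod_comp_eq_prod_pow_count σ fun l => (s (j l) : ℝ≥0∞)]
  simp only [Function.comp_def]
  ring

theorem lintegral_sampleIntegrand_pattern {E : Type*} (H : Measure ℝ≥0)
    [IsProbabilityMeasure H] {n k : ℕ} {σ : Fin n → Fin k}
    (hσ : Function.Surjective σ) {c : Config E} (hc : c.IsSimple)
    (F : (Fin n → E) × ℝ → ℝ≥0∞) (u : ℝ) :
    ∫⁻ s, sampleIntegrand ((Prod.fst ⁻¹' pattern E σ).indicator F) (c, s) u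
        ∂(Measure.infinitePi fun _ => H)
      = gammaFactor n u * (∏ l, kappa H u (count σ l)) *
          ((∑ j : Fin k ↪ Fin c.1, F ((fun l => c.2 (j l)) ∘ σ, u)) * kappa H u 0 ^ (c.1 - k)) := by
  have ht : Measurable fun s : ℕ → ℝ≥0 => total (c, s) := by
    unfold total; dsimp only; fun_prop
  simp only [sampleIntegrand_pattern hσ hc]
  rw [lintegral_const_mul _ (by fun_prop), lintegral_finsetSum _ fun j _ => by fun_prop]
  simp only [mul_assoc, Finset.sum_mul, Finset.mul_sum]
  refine Finset.sum_congr rfl fun j _ => ?_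
  rw [lintegral_const_mul _ (by fun_prop), lintegral_marks]
  ring

theorem lintegral_markedLaw_sampleIntegrand_pattern {E : Type*} [MeasurableSpace E]
    [MeasurableEq E] {PΦ : Measure (Config E)} (hΦ : ∀ᵐ c ∂PΦ, c.IsSimple)
    (H : Measure ℝ≥0) [IsProbabilityMeasure H] {n k : ℕ} {σ : Fin n → Fin k}
    (hσ : Function.Surjective σ)
    {Q : Kernel (Fin k → E) (Config E)} [IsMarkovKernel Q] (hQ : IsReducedPalm PΦ k Q)
    {F : (Fin n → E) × ℝ → ℝ≥0∞} (hF : Measurable F) (u : ℝ) :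
    ∫⁻ ω, sampleIntegrand ((Prod.fst ⁻¹' pattern E σ).indicator F) ω u ∂(markedLaw PΦ H)
      = ∫⁻ x, gammaFactor n u * (∏ l, kappa H u (count σ l))
          * (F (x ∘ σ, u) * laplace (Q x) H fun _ => u) ∂(momentMeasure PΦ k) := by
  have hP : MeasurableSet ((Prod.fst : (Fin n → E) × ℝ → _) ⁻¹' pattern E σ) :=
    measurable_fst (measurableSet_pattern hσ)
  have hS := measurable_sampleIntegrand (hF.indicator hP)
  have hFu : Measurable fun x : Fin k → E => F (x ∘ σ, u) := by
    have : Measurable fun x : Fin k → E => x ∘ σ := by fun_prop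
    fun_prop
  have hLu : Measurable fun x : Fin k → E => laplace (Q x) H fun _ => u :=
    (measurable_laplace Q H).comp (measurable_prodMk_right (y := u))
  have hSu : Measurable fun ω : Config E × (ℕ → ℝ≥0) =>
      sampleIntegrand ((Prod.fst ⁻¹' pattern E σ).indicator F) ω u :=
    hS.of_uncurry_right
  have hFL : Measurable fun x : Fin k → E => F (x ∘ σ, u) * laplace (Q x) H fun _ => u :=
    hFu.mul hLu
  have h1 := lintegral_sum_embedding_mul hQ hFu fun r => kappa H u 0 ^ r
  simp only [← laplace_const] at h1
  have hM : Measurable fun c : Config E =>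
      (∑ j : Fin k ↪ Fin c.1, F ((fun l => c.2 (j l)) ∘ σ, u)) * kappa H u 0 ^ (c.1 - k) :=
    (measurable_sum_embedding hFu).mul
      ((measurable_of_countable fun r : ℕ => kappa H u 0 ^ (r - k)).comp measurable_fst)
  rw [markedLaw, lintegral_prod _ hSu.aemeasurable, lintegral_const_mul _ hFL, ← h1,
    ← lintegral_const_mul _ hM]
  refine lintegral_congr_ae ?_
  filter_upwards [hΦ] with c hc
  rw [lintegral_sampleIntegrand_pattern H hσ hc F u]

/-- The law of `(Y_1, …, Y_n, U)` on the event that the observations have the pattern `σ`. -/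
theorem setLIntegral_sampleLaw_pattern_gammaFactor {E : Type*} [MeasurableSpace E]
    [MeasurableEq E]
    {PΦ : Measure (Config E)} [IsProbabilityMeasure PΦ] (hΦ : ∀ᵐ c ∂PΦ, c.IsSimple)
    (H : Measure ℝ≥0) [IsProbabilityMeasure H] {n k : ℕ} (hn : 1 ≤ n) {σ : Fin n → Fin k}
    (hσ : Function.Surjective σ) [SFinite (momentMeasure PΦ k)]
    {Q : Kernel (Fin k → E) (Config E)} [IsMarkovKernel Q] (hQ : IsReducedPalm PΦ k Q)
    {F : (Fin n → E) × ℝ → ℝ≥0∞} (hF : Measurable F) :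
    ∫⁻ p in Prod.fst ⁻¹' pattern E σ, F p ∂(sampleLaw PΦ H n n)
      = ∫⁻ x, (∫⁻ u in Set.Ioi 0, gammaFactor n u * (∏ l, kappa H u (count σ l))
          * (F (x ∘ σ, u) * laplace (Q x) H fun _ => u)) ∂(momentMeasure PΦ k) := by
  have hP : MeasurableSet ((Prod.fst : (Fin n → E) × ℝ → _) ⁻¹' pattern E σ) :=
    measurable_fst (measurableSet_pattern hσ)
  have hS := measurable_sampleIntegrand (hF.indicator hP)
  have hcomp : Measurable fun x : Fin k → E => x ∘ σ := by fun_prop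
  have hL := measurable_laplace Q H
  have hR : Measurable fun p : (Fin k → E) × ℝ => gammaFactor n p.2
      * (∏ l, kappa H p.2 (count σ l)) * (F (p.1 ∘ σ, p.2) * laplace (Q p.1) H fun _ => p.2) := by
    fun_prop
  -- The Campbell formula holds at each fixed `u`, so Tonelli is applied on both sides to bring the
  -- integral over `u` outside.
  rw [← lintegral_indicator hP, lintegral_sampleLaw PΦ H hn (hF.indicator hP),
    lintegral_lintegral_swap hS.aemeasurable,
    lintegral_lintegral_swap (μ := momentMeasure PΦ k) hR.aemeasurable]
  exact lintegral_congr fun u =>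
    lintegral_markedLaw_sampleIntegrand_pattern hΦ H hσ hQ hF u

/-! ### Conditional distributions on an event -/

/-- A measurable family of measures which has the defining property of the conditional
distribution of `Z` given `Y` on the event `Y ∈ S` is almost surely equal to it there. -/
theorem condDistrib_ae_eq_on {Ω α β : Type*} [MeasurableSpace Ω] [MeasurableSpace α]
    [MeasurableSpace β] [StandardBorelSpace β] [Nonempty β] {μ : Measure Ω} [IsFiniteMeasure μ]
    {Y : Ω → α} {Z : Ω → β} (hY : Measurable Y) (hZ : Measurable Z) {S : Set α}
    (hS : MeasurableSet S) {K : α → Measure β} (hK : Measurable K)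
    (hF : ∀ F : α × β → ℝ≥0∞, Measurable F →
      ∫⁻ y in S, (∫⁻ z, F (y, z) ∂(K y)) ∂(μ.map Y) = ∫⁻ ω in Y ⁻¹' S, F (Y ω, Z ω) ∂μ) :
    ∀ᵐ ω ∂μ, Y ω ∈ S → condDistrib Z Y μ (Y ω) = K (Y ω) := by
  classical
  have h : ∀ T C, MeasurableSet T → MeasurableSet C → T ⊆ S →
      ∫⁻ y in T, K y C ∂(μ.map Y) = μ (Y ⁻¹' T ∩ Z ⁻¹' C) := fun T C hT hC hTS => by
    have h1 := hF ((T ×ˢ C).indicator 1) (measurable_one.indicator (hT.prod hC))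
    have h2 : ∀ y, ∫⁻ z, (T ×ˢ C).indicator 1 (y, z) ∂(K y) = T.indicator (fun y => K y C) y := by
      intro y
      have : ∀ z, (T ×ˢ C).indicator (1 : α × β → ℝ≥0∞) (y, z)
          = T.indicator (fun _ => C.indicator 1 z) y := fun z => by
        by_cases hy : y ∈ T <;> by_cases hz : z ∈ C <;> simp [hy, hz]
      by_cases hy : y ∈ T <;> simp [this, hy, lintegral_indicator_one hC]
    have h3 : ∀ ω, (T ×ˢ C).indicator (1 : α × β → ℝ≥0∞) (Y ω, Z ω)
        = (Y ⁻¹' T ∩ Z ⁻¹' C).indicator 1 ω := fun ω => by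
      simp [Set.indicator_apply]
    simp only [h2, h3] at h1
    rw [setLIntegral_indicator hT, Set.inter_eq_left.2 hTS,
      lintegral_indicator_one ((hY hT).inter (hZ hC)),
      Measure.restrict_apply ((hY hT).inter (hZ hC)), Set.inter_eq_left.2] at h1
    · exact h1
    · exact fun ω hω => hTS hω.1
  have hKu : Measurable fun y => K y Set.univ := Measure.measurable_coe .univ |>.comp hK
  have hle : MeasurableSet {y | K y Set.univ ≤ 1} := hKu measurableSet_Iic
  -- Nothing bounds the mass of `K y` beforehand. Cutting it to zero where the mass exceeds one
  -- gives a finite kernel, as the uniqueness theorem requires.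
  let η : Kernel α β :=
    ⟨fun y => if K y Set.univ ≤ 1 then K y else 0, Measurable.ite hle hK measurable_const⟩
  have hη : ∀ y, η y = if K y Set.univ ≤ 1 then K y else 0 := fun _ => rfl
  have : IsFiniteKernel η := ⟨⟨1, ENNReal.one_lt_top, fun y => by
    rw [hη]; split_ifs with hy
    · exact hy
    · simp⟩⟩
  -- Taking `C = univ` in the rectangle identity shows that the mass is almost surely one on `S`, so
  -- the cut changes nothing there.
  have hone : ∀ᵐ y ∂((μ.map Y).restrict S), K y Set.univ = 1 := by
    refine ae_eq_of_forall_setLIntegral_eq_of_sigmaFinite hKu measurable_const fun T hT _ => ?_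
    rw [Measure.restrict_restrict hT, h _ _ (hT.inter hS) .univ Set.inter_subset_right]
    simp [Measure.map_apply hY (hT.inter hS)]
  have hKη : ∀ᵐ y ∂((μ.map Y).restrict S), η y = K y := by
    filter_upwards [hone] with y hy
    rw [hη, if_pos hy.le]
  have key : condDistrib Z Y μ =ᵐ[(μ.map Y).restrict S] η := by
    refine Kernel.ae_eq_of_compProd_eq (Measure.ext_prod fun {T C} hT hC => ?_)
    rw [Measure.compProd_apply_prod hT hC, Measure.compProd_apply_prod hT hC,
      Measure.restrict_restrict hT, ← Measure.compProd_apply_prod (hT.inter hS) hC,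
      compProd_map_condDistrib hZ.aemeasurable,
      Measure.map_apply (hY.prodMk hZ) ((hT.inter hS).prod hC), Set.mk_preimage_prod,
      ← h _ _ (hT.inter hS) hC Set.inter_subset_right]
    rw [← Measure.restrict_restrict hT]
    refine lintegral_congr_ae (ae_restrict_of_ae ?_)
    filter_upwards [hKη] with y hy
    rw [hy]
  have := (ae_restrict_iff' hS).1 (key.and hKη)
  filter_upwards [ae_of_ae_map hY.aemeasurable this] with ω hω hS
  rw [(hω hS).1, (hω hS).2]

/-! ### Disintegration of the moment measure of order `k + 1` -/

/-- Dropping the last entry of a tuple of different points leaves a tuple of different points. If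
almost surely no `k`-tuple lies in `B`, then no `(k+1)`-tuple starts in `B`. -/
theorem momentMeasure_succ_null {E : Type*} [MeasurableSpace E] {PΦ : Measure (Config E)} {k : ℕ}
    {B : Set (Fin k → E)} (hB : MeasurableSet B) (h : momentMeasure PΦ k B = 0) :
    momentMeasure PΦ (k + 1) (Fin.init ⁻¹' B) = 0 := by
  have hi : Measurable fun z : Fin (k + 1) → E => (Fin.init z : Fin k → E) :=
    measurable_pi_lambda _ fun i => measurable_pi_apply i.castSucc
  have h1 : Measurable (B.indicator (1 : (Fin k → E) → ℝ≥0∞)) := measurable_one.indicator hB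
  rw [← lintegral_indicator_one hB, lintegral_momentMeasure _ _ h1,
    lintegral_eq_zero_iff (measurable_sum_embedding h1)] at h
  rw [← lintegral_indicator_one (hi hB),
    lintegral_momentMeasure _ _ (measurable_one.indicator (hi hB))]
  refine (lintegral_congr_ae ?_).trans lintegral_zero
  filter_upwards [h] with c hc
  refine Finset.sum_eq_zero fun j _ => ?_
  exact Finset.sum_eq_zero_iff.1 hc (Fin.castSuccEmb.trans j) (Finset.mem_univ _)

@[fun_prop]
theorem measurable_momentDensity {E : Type*} [MeasurableSpace E] (PΦ : Measure (Config E))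
    (P₀ : Measure E) (k : ℕ) : Measurable (momentDensity PΦ P₀ k) :=
  Measure.measurable_rnDeriv _ _

@[fun_prop]
theorem measurable_snoc {E : Type*} [MeasurableSpace E] (k : ℕ) :
    Measurable fun p : (Fin k → E) × E => (Fin.snoc (α := fun _ => E) p.1 p.2) := by
  refine measurable_pi_lambda _ fun i => ?_
  refine Fin.lastCases ?_ (fun i => ?_) i
  · simpa using measurable_snd
  · simpa [Function.comp_def] using (measurable_pi_apply i).comp measurable_fst

theorem lintegral_pi_succ {E : Type*} [MeasurableSpace E] (P₀ : Measure E) [SigmaFinite P₀]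
    {k : ℕ} {f : (Fin (k + 1) → E) → ℝ≥0∞} (hf : Measurable f) :
    ∫⁻ z, f z ∂(Measure.pi fun _ => P₀)
      = ∫⁻ x, (∫⁻ y, f (Fin.snoc (α := fun _ => E) x y) ∂P₀) ∂(Measure.pi fun _ => P₀) := by
  have h := (measurePreserving_piFinSuccAbove (fun _ : Fin (k + 1) => P₀) (Fin.last k)).symm
  rw [← h.lintegral_comp hf, lintegral_prod_symm _ (by fun_prop)]
  refine lintegral_congr fun x => lintegral_congr fun y => ?_
  congr 1
  exact Fin.insertNth_last' y x

/-- Dividing by `m_k` is legitimate because `M_{k+1}` does not charge the tuples whose first `k`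
entries lie in the zero set of `m_k`, and `σ`-finiteness makes `m_k` finite almost everywhere. -/
theorem lintegral_momentMeasure_succ {E : Type*} [MeasurableSpace E] {PΦ : Measure (Config E)}
    {P₀ : Measure E} [SigmaFinite P₀] {k : ℕ} [SigmaFinite (momentMeasure PΦ k)]
    [SigmaFinite (momentMeasure PΦ (k + 1))]
    (hk : momentMeasure PΦ k ≪ Measure.pi fun _ => P₀)
    (hk' : momentMeasure PΦ (k + 1) ≪ Measure.pi fun _ => P₀)
    {f : (Fin (k + 1) → E) → ℝ≥0∞} (hf : Measurable f) :
    ∫⁻ z, f z ∂(momentMeasure PΦ (k + 1))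
      = ∫⁻ x, (∫⁻ y, momentDensity PΦ P₀ (k + 1) (Fin.snoc (α := fun _ => E) x y)
          / momentDensity PΦ P₀ k x * f (Fin.snoc (α := fun _ => E) x y) ∂P₀)
          ∂(momentMeasure PΦ k) := by
  have hwd : momentMeasure PΦ k = (Measure.pi fun _ => P₀).withDensity (momentDensity PΦ P₀ k) :=
    (Measure.withDensity_rnDeriv_eq _ _ hk).symm
  have hwd' : momentMeasure PΦ (k + 1)
      = (Measure.pi fun _ => P₀).withDensity (momentDensity PΦ P₀ (k + 1)) :=
    (Measure.withDensity_rnDeriv_eq _ _ hk').symm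
  have hm := measurable_momentDensity PΦ P₀ k
  have hm' := measurable_momentDensity PΦ P₀ (k + 1)
  have hB : MeasurableSet {x | momentDensity PΦ P₀ k x = 0} := hm (measurableSet_singleton 0)
  have hB0 : momentMeasure PΦ k {x | momentDensity PΦ P₀ k x = 0} = 0 := by
    rw [hwd, withDensity_apply _ hB]
    exact (setLIntegral_congr_fun hB fun x hx => hx).trans lintegral_zero
  have hi : Measurable fun z : Fin (k + 1) → E => (Fin.init z : Fin k → E) :=
    measurable_pi_lambda _ fun i => measurable_pi_apply i.castSucc
  have hD := hi hB.compl
  have hae : ∀ᵐ z ∂(momentMeasure PΦ (k + 1)),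
      (Fin.init z : Fin k → E) ∈ {x | momentDensity PΦ P₀ k x = 0}ᶜ := by
    rw [ae_iff]
    simpa using momentMeasure_succ_null hB hB0
  have h1 : ∫⁻ z, f z ∂(momentMeasure PΦ (k + 1))
      = ∫⁻ z, (Fin.init ⁻¹' {x | momentDensity PΦ P₀ k x = 0}ᶜ).indicator f z
          ∂(momentMeasure PΦ (k + 1)) := by
    refine lintegral_congr_ae ?_
    filter_upwards [hae] with z hz
    exact (Set.indicator_of_mem (s := Fin.init ⁻¹' _) hz f).symm
  have hfin : ∀ᵐ x ∂(Measure.pi fun _ => P₀), momentDensity PΦ P₀ k x < ∞ :=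
    Measure.rnDeriv_lt_top _ _
  rw [h1, hwd', lintegral_withDensity_eq_lintegral_mul _ hm' (hf.indicator hD),
    lintegral_pi_succ P₀ (hm'.mul (hf.indicator hD)), hwd,
    lintegral_withDensity_eq_lintegral_mul _ hm (Measurable.lintegral_prod_right' (f :=
      fun p : (Fin k → E) × E => momentDensity PΦ P₀ (k + 1) (Fin.snoc (α := fun _ => E) p.1 p.2)
          / momentDensity PΦ P₀ k p.1 * f (Fin.snoc (α := fun _ => E) p.1 p.2)) (by fun_prop))]
  refine lintegral_congr_ae ?_
  filter_upwards [hfin] with x hx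
  simp only [Pi.mul_apply]
  -- On the zero set of `m_k` the left side vanishes through the indicator inserted above and the
  -- right side through the factor `m_k`.
  rcases eq_or_ne (momentDensity PΦ P₀ k x) 0 with h0 | h0
  · simp [h0]
  · rw [← lintegral_const_mul _ (by fun_prop)]
    refine lintegral_congr fun y => ?_
    rw [Set.indicator_of_mem (by simpa using h0), ← mul_assoc,
      ENNReal.mul_div_cancel h0 hx.ne]

/-! ### The latent weights -/

theorem kappa_ne_top (H : Measure ℝ≥0) [IsProbabilityMeasure H] {u : ℝ} (hu : 0 < u) (m : ℕ) :
    kappa H u m ≠ ∞ := by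
  have hb : ∀ s : ℝ≥0, ENNReal.ofReal (Real.exp (-(u * s))) * (s : ℝ≥0∞) ^ m
      ≤ ENNReal.ofReal (m.factorial / u ^ m) := fun s => by
    rw [← ENNReal.ofReal_coe_nnreal, ← ENNReal.ofReal_pow s.coe_nonneg,
      ← ENNReal.ofReal_mul (Real.exp_pos _).le]
    refine ENNReal.ofReal_le_ofReal ?_
    -- One term of the exponential series bounds the integrand uniformly: `(us)^m / m! ≤ e^{us}`
    -- gives `e^{-us} s^m ≤ m! / u^m`.
    have h1 := Real.pow_div_factorial_le_exp (u * s) (by positivity) m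
    have hf : (0 : ℝ) < m.factorial := by positivity
    rw [div_le_iff₀ hf, mul_pow] at h1
    rw [Real.exp_neg, le_div_iff₀ (by positivity), inv_mul_eq_div, div_mul_eq_mul_div,
      div_le_iff₀ (Real.exp_pos _)]
    linarith
  refine ((lintegral_mono hb).trans_lt ?_).ne
  simp

/-- For `m ≥ 1` the moment can vanish only if the marks are almost surely zero, and then all higher
moments vanish too. This makes the quotient `0 / 0` in the old weights harmless. -/
theorem kappa_succ_eq_zero {H : Measure ℝ≥0} [SFinite H] {u : ℝ} {m : ℕ} (hm : 1 ≤ m)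
    (h : kappa H u m = 0) : kappa H u (m + 1) = 0 := by
  rw [kappa, lintegral_eq_zero_iff (by fun_prop)] at h ⊢
  filter_upwards [h] with s hs
  have : s = 0 := by
    have hs' : ENNReal.ofReal (Real.exp (-(u * s))) * (s : ℝ≥0∞) ^ m = 0 := hs
    have he : ENNReal.ofReal (Real.exp (-(u * s))) ≠ 0 := by
      simp [Real.exp_pos]
    simpa [he, Nat.pos_iff_ne_zero.1 hm] using hs'
  simp [this]

theorem kappa_div_mul_cancel (H : Measure ℝ≥0) [IsProbabilityMeasure H] {u : ℝ} (hu : 0 < u)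
    {m : ℕ} (hm : 1 ≤ m) : kappa H u (m + 1) / kappa H u m * kappa H u m = kappa H u (m + 1) := by
  rcases eq_or_ne (kappa H u m) 0 with h | h
  · rw [h, kappa_succ_eq_zero hm h, mul_zero]
  · exact ENNReal.div_mul_cancel h (kappa_ne_top H hu m)

theorem kappa_zero_pos (H : Measure ℝ≥0) [IsProbabilityMeasure H] (u : ℝ) : kappa H u 0 ≠ 0 := by
  rw [kappa, Ne, lintegral_eq_zero_iff (by fun_prop)]
  intro h
  obtain ⟨s, hs⟩ := h.exists
  simp at hs
  exact absurd hs (not_le.2 (Real.exp_pos _))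

theorem laplace_ne_zero {E : Type*} [MeasurableSpace E] (P : Measure (Config E))
    [IsProbabilityMeasure P] (H : Measure ℝ≥0) [IsProbabilityMeasure H] (u : ℝ) :
    laplace P H (fun _ => u) ≠ 0 := by
  have hm : Measurable fun c : Config E => kappa H u 0 ^ c.1 :=
    (measurable_of_countable fun r : ℕ => kappa H u 0 ^ r).comp measurable_fst
  rw [laplace_const, Ne, lintegral_eq_zero_iff hm]
  intro h
  obtain ⟨c, hc⟩ := h.exists
  exact pow_ne_zero _ (kappa_zero_pos H u) hc

theorem laplace_ne_top {E : Type*} [MeasurableSpace E] (P : Measure (Config E))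
    [IsProbabilityMeasure P] (H : Measure ℝ≥0) [IsProbabilityMeasure H] {u : ℝ} (hu : 0 < u) :
    laplace P H (fun _ => u) ≠ ∞ := by
  have h1 : kappa H u 0 ≤ 1 := by
    rw [kappa]
    refine (lintegral_mono (g := fun _ => 1) fun s => ?_).trans (by simp)
    simp only [pow_zero, mul_one, ENNReal.ofReal_le_one, Real.exp_le_one_iff]
    have : 0 ≤ u * s := by positivity
    linarith
  rw [laplace_const]
  refine ((lintegral_mono (g := fun _ => 1) fun c => pow_le_one' h1 _).trans_lt ?_).ne
  simp

theorem one_le_count {n k : ℕ} {σ : Fin n → Fin k} (hσ : Function.Surjective σ) (j : Fin k) :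
    1 ≤ count σ j := by
  obtain ⟨i, hi⟩ := hσ j
  exact Finset.card_pos.2 ⟨i, by simp [hi]⟩

/-! ### Counts and latent weights after one more observation -/

theorem count_succ {n k : ℕ} (τ : Fin (n + 1) → Fin k) (l : Fin k) :
    count τ l = count (Fin.init τ : Fin n → Fin k) l + if τ (Fin.last n) = l then 1 else 0 := by
  simp only [count, Finset.card_filter, Fin.sum_univ_castSucc]
  rfl

theorem count_castSucc_comp {n k : ℕ} (σ : Fin n → Fin k) (l : Fin k) :
    count (Fin.castSucc ∘ σ) l.castSucc = count σ l := by
  simp [count]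

theorem count_castSucc_comp_last {n k : ℕ} (σ : Fin n → Fin k) :
    count (Fin.castSucc ∘ σ) (Fin.last k) = 0 := by
  simp [count, Fin.castSucc_ne_last]

/-- The allocation in which the new observation joins the old value `j`. -/
def joinOld {n k : ℕ} (σ : Fin n → Fin k) (j : Fin k) : Fin (n + 1) → Fin k :=
  Fin.snoc (α := fun _ => Fin k) σ j

/-- The allocation in which the new observation has a new value. -/
def joinNew {n k : ℕ} (σ : Fin n → Fin k) : Fin (n + 1) → Fin (k + 1) :=
  Fin.snoc (α := fun _ => Fin (k + 1)) (Fin.castSucc ∘ σ) (Fin.last k)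

theorem joinOld_surjective {n k : ℕ} {σ : Fin n → Fin k} (hσ : Function.Surjective σ) (j : Fin k) :
    Function.Surjective (joinOld σ j) := fun l => by
  obtain ⟨i, rfl⟩ := hσ l
  exact ⟨i.castSucc, by simp [joinOld]⟩

theorem joinNew_surjective {n k : ℕ} {σ : Fin n → Fin k} (hσ : Function.Surjective σ) :
    Function.Surjective (joinNew σ) := fun l => by
  refine Fin.lastCases ⟨Fin.last n, by simp [joinNew]⟩ (fun l => ?_) l
  obtain ⟨i, rfl⟩ := hσ l
  exact ⟨i.castSucc, by simp [joinNew]⟩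

theorem latentWeight_of_pos {E : Type*} [MeasurableSpace E] {n k : ℕ} (H : Measure ℝ≥0)
    (Q : Kernel (Fin k → E) (Config E)) (σ : Fin n → Fin k) (x : Fin k → E) {u : ℝ} (hu : 0 < u) :
    latentWeight H Q σ x u = ENNReal.ofReal (u ^ (n - 1)) * laplace (Q x) H (fun _ => u)
      * ∏ j, kappa H u (count σ j) :=
  Set.indicator_of_mem (Set.mem_Ioi.2 hu) _

theorem latentWeight_of_nonpos {E : Type*} [MeasurableSpace E] {n k : ℕ} (H : Measure ℝ≥0)
    (Q : Kernel (Fin k → E) (Config E)) (σ : Fin n → Fin k) (x : Fin k → E) {u : ℝ} (hu : u ≤ 0) :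
    latentWeight H Q σ x u = 0 :=
  Set.indicator_of_notMem (by simpa using hu) _

/-- No new point enters, so the Palm process is unchanged. Only the moment at table `j` is raised by
one order, and the exponent of `u` by one. -/
theorem latentWeight_joinOld {E : Type*} [MeasurableSpace E] {n k : ℕ} (hn : 1 ≤ n)
    (H : Measure ℝ≥0) [IsProbabilityMeasure H] (Q : Kernel (Fin k → E) (Config E))
    {σ : Fin n → Fin k} (hσ : Function.Surjective σ) (j : Fin k) (x : Fin k → E) (u : ℝ) :
    latentWeight H Q (joinOld σ j) x u
      = ENNReal.ofReal u * (oldWeight H σ u j * latentWeight H Q σ x u) := by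
  rcases le_or_gt u 0 with hu | hu
  · simp [latentWeight_of_nonpos _ _ _ _ hu]
  have hp : ∏ l, kappa H u (count (joinOld σ j) l)
      = oldWeight H σ u j * ∏ l, kappa H u (count σ l) := by
    rw [← Finset.mul_prod_erase _ _ (Finset.mem_univ j),
      ← Finset.mul_prod_erase _ (fun l => kappa H u (count σ l)) (Finset.mem_univ j), ← mul_assoc]
    congr 1
    · rw [oldWeight, kappa_div_mul_cancel H hu (one_le_count hσ j), count_succ]
      simp [joinOld, Fin.init_snoc]
    · refine Finset.prod_congr rfl fun l hl => ?_
      have : j ≠ l := (Finset.ne_of_mem_erase hl).symm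
      rw [count_succ]
      simp [joinOld, Fin.init_snoc, this]
  rw [latentWeight_of_pos _ _ _ _ hu, latentWeight_of_pos _ _ _ _ hu, hp]
  -- The exponents are truncated differences; `n ≥ 1` makes the new one exactly one larger.
  have : ENNReal.ofReal (u ^ (n + 1 - 1)) = ENNReal.ofReal u * ENNReal.ofReal (u ^ (n - 1)) := by
    rw [← ENNReal.ofReal_mul hu.le, ← pow_succ']
    congr 2; omega
  rw [this]
  ring

/-- The new table has count one, giving the factor `κ(u, 1)`, and the Palm process passes to order
`k + 1`. The ratio of Laplace functionals is genuine because its denominator lies in `(0, ∞)` for `u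
> 0`. -/
theorem latentWeight_joinNew {E : Type*} [MeasurableSpace E] {n k : ℕ} (hn : 1 ≤ n)
    (H : Measure ℝ≥0) [IsProbabilityMeasure H] (Q : Kernel (Fin k → E) (Config E))
    [IsMarkovKernel Q] (Q' : Kernel (Fin (k + 1) → E) (Config E)) (σ : Fin n → Fin k)
    (x : Fin k → E) (y : E) (u : ℝ) :
    latentWeight H Q' (joinNew σ) (Fin.snoc (α := fun _ => E) x y) u
      = ENNReal.ofReal u * (kappa H u 1 *
          (laplace (Q' (Fin.snoc (α := fun _ => E) x y)) H (fun _ => u)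
            / laplace (Q x) H (fun _ => u)) * latentWeight H Q σ x u) := by
  rcases le_or_gt u 0 with hu | hu
  · simp [latentWeight_of_nonpos _ _ _ _ hu]
  have hp : ∏ l, kappa H u (count (joinNew σ) l)
      = (∏ l, kappa H u (count σ l)) * kappa H u 1 := by
    rw [Fin.prod_univ_castSucc]
    congr 1
    · refine Finset.prod_congr rfl fun l _ => ?_
      rw [count_succ]
      simp [joinNew, Fin.init_snoc, count_castSucc_comp, (Fin.castSucc_ne_last l).symm]
    · rw [count_succ]
      simp [joinNew, Fin.init_snoc, count_castSucc_comp_last]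
  rw [latentWeight_of_pos _ _ _ _ hu, latentWeight_of_pos _ _ _ _ hu, hp]
  have : ENNReal.ofReal (u ^ (n + 1 - 1)) = ENNReal.ofReal u * ENNReal.ofReal (u ^ (n - 1)) := by
    rw [← ENNReal.ofReal_mul hu.le, ← pow_succ']
    congr 2; omega
  have hd := ENNReal.div_mul_cancel (b := laplace (Q' (Fin.snoc (α := fun _ => E) x y)) H
    (fun _ => u)) (laplace_ne_zero (Q x) H u) (laplace_ne_top (Q x) H hu)
  rw [this]
  conv_lhs => rw [← hd]
  ring

theorem measurable_latentWeight {E : Type*} [MeasurableSpace E] {n k : ℕ} (H : Measure ℝ≥0)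
    [IsProbabilityMeasure H] (Q : Kernel (Fin k → E) (Config E)) [IsMarkovKernel Q]
    (σ : Fin n → Fin k) :
    Measurable fun p : (Fin k → E) × ℝ => latentWeight H Q σ p.1 p.2 := by
  have hL := measurable_laplace Q H
  have : Measurable fun p : (Fin k → E) × ℝ => ENNReal.ofReal (p.2 ^ (n - 1))
      * laplace (Q p.1) H (fun _ => p.2) * ∏ j, kappa H p.2 (count σ j) := by fun_prop
  exact this.indicator (measurable_snd measurableSet_Ioi)

theorem measurable_latentDensity {E : Type*} [MeasurableSpace E] {n k : ℕ} (H : Measure ℝ≥0)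
    [IsProbabilityMeasure H] (Q : Kernel (Fin k → E) (Config E)) [IsMarkovKernel Q]
    (σ : Fin n → Fin k) :
    Measurable fun p : (Fin k → E) × ℝ => latentDensity H Q σ p.1 p.2 := by
  have h := measurable_latentWeight H Q σ
  have h2 : Measurable fun x : Fin k → E => ∫⁻ v, latentWeight H Q σ x v :=
    h.lintegral_prod_right'
  unfold latentDensity
  exact h.div (h2.comp measurable_fst)

/-- The normalization can be undone even when the constant is zero, since the weight is then zero
almost everywhere. Only an infinite constant must be excluded. -/
theorem lintegral_mul_latentDensity {E : Type*} [MeasurableSpace E] {n k : ℕ} (H : Measure ℝ≥0)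
    [IsProbabilityMeasure H] (Q : Kernel (Fin k → E) (Config E)) [IsMarkovKernel Q]
    (σ : Fin n → Fin k) (x : Fin k → E) (hx : ∫⁻ v, latentWeight H Q σ x v ≠ ∞)
    {h : ℝ → ℝ≥0∞} (hh : Measurable h) :
    (∫⁻ v, latentWeight H Q σ x v) * ∫⁻ u, h u * latentDensity H Q σ x u
      = ∫⁻ u, h u * latentWeight H Q σ x u := by
  have hW : Measurable (latentWeight H Q σ x) :=
    (measurable_latentWeight H Q σ).of_uncurry_left (x := x)
  simp only [latentDensity]
  rcases eq_or_ne (∫⁻ v, latentWeight H Q σ x v) 0 with h0 | h0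
  · rw [h0, zero_mul]
    symm
    rw [lintegral_eq_zero_iff hW] at h0
    refine (lintegral_congr_ae ?_).trans lintegral_zero
    filter_upwards [h0] with u hu
    simp [hu]
  · rw [← lintegral_const_mul _ (by fun_prop)]
    refine lintegral_congr fun u => ?_
    rw [mul_left_comm, ENNReal.mul_div_cancel h0 hx]

/-! ### The joint law of the sample and the auxiliary variable -/

theorem setLIntegral_sampleLaw_pattern {E : Type*} [MeasurableSpace E] [MeasurableEq E]
    {PΦ : Measure (Config E)} [IsProbabilityMeasure PΦ] (hΦ : ∀ᵐ c ∂PΦ, c.IsSimple)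
    (H : Measure ℝ≥0) [IsProbabilityMeasure H] {n k : ℕ} (hn : 1 ≤ n) {σ : Fin n → Fin k}
    (hσ : Function.Surjective σ) [SFinite (momentMeasure PΦ k)]
    {Q : Kernel (Fin k → E) (Config E)} [IsMarkovKernel Q] (hQ : IsReducedPalm PΦ k Q)
    {F : (Fin n → E) × ℝ → ℝ≥0∞} (hF : Measurable F) :
    ∫⁻ p in Prod.fst ⁻¹' pattern E σ, F p ∂(sampleLaw PΦ H n n)
      = (ENNReal.ofReal (Real.Gamma n))⁻¹ *
          ∫⁻ x, (∫⁻ u, F (x ∘ σ, u) * latentWeight H Q σ x u) ∂(momentMeasure PΦ k) := by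
  have hG : 0 < Real.Gamma n := Real.Gamma_pos_of_pos (by exact_mod_cast hn)
  have hW := measurable_latentWeight H Q σ
  have hcomp : Measurable fun x : Fin k → E => x ∘ σ := by fun_prop
  have hFW : Measurable fun p : (Fin k → E) × ℝ => F (p.1 ∘ σ, p.2)
      * latentWeight H Q σ p.1 p.2 := by fun_prop
  rw [setLIntegral_sampleLaw_pattern_gammaFactor hΦ H hn hσ hQ hF,
    ← lintegral_const_mul _ hFW.lintegral_prod_right']
  refine lintegral_congr fun x => ?_
  have hx : Measurable fun u => F (x ∘ σ, u) * latentWeight H Q σ x u :=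
    hFW.comp (measurable_prodMk_left (x := x))
  rw [← lintegral_const_mul _ hx, ← lintegral_indicator measurableSet_Ioi]
  refine lintegral_congr fun u => ?_
  rcases le_or_gt u 0 with hu | hu
  · rw [latentWeight_of_nonpos _ _ _ _ hu, Set.indicator_of_notMem (by simpa using hu)]
    simp
  · rw [latentWeight_of_pos _ _ _ _ hu, Set.indicator_of_mem (Set.mem_Ioi.2 hu), gammaFactor,
      ENNReal.ofReal_div_of_pos hG, div_eq_mul_inv]
    ring

theorem setLIntegral_map_sampleLaw {E : Type*} [MeasurableSpace E] [MeasurableEq E]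
    {PΦ : Measure (Config E)} [IsProbabilityMeasure PΦ] (hΦ : ∀ᵐ c ∂PΦ, c.IsSimple)
    (H : Measure ℝ≥0) [IsProbabilityMeasure H] {n k : ℕ} (hn : 1 ≤ n) {σ : Fin n → Fin k}
    (hσ : Function.Surjective σ) [SFinite (momentMeasure PΦ k)]
    {Q : Kernel (Fin k → E) (Config E)} [IsMarkovKernel Q] (hQ : IsReducedPalm PΦ k Q)
    {g : (Fin n → E) → ℝ≥0∞} (hg : Measurable g) :
    ∫⁻ y in pattern E σ, g y ∂((sampleLaw PΦ H n n).map Prod.fst)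
      = (ENNReal.ofReal (Real.Gamma n))⁻¹ *
          ∫⁻ x, g (x ∘ σ) * (∫⁻ u, latentWeight H Q σ x u) ∂(momentMeasure PΦ k) := by
  have hW := measurable_latentWeight H Q σ
  rw [setLIntegral_map (measurableSet_pattern hσ) hg measurable_fst,
    setLIntegral_sampleLaw_pattern hΦ H hn hσ hQ (F := fun p => g p.1) (hg.comp measurable_fst)]
  congr 1
  refine lintegral_congr fun x => ?_
  have hWx : Measurable (latentWeight H Q σ x) := hW.comp (measurable_prodMk_left (x := x))
  exact lintegral_const_mul (g (x ∘ σ)) hWx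

/-- Integrated against `M_k`, the normalizing constant gives `Γ(n)` times the mass of the pattern
under the sample law, which is finite. -/
theorem ae_lintegral_latentWeight_ne_top {E : Type*} [MeasurableSpace E] [MeasurableEq E]
    {PΦ : Measure (Config E)} [IsProbabilityMeasure PΦ] (hΦ : ∀ᵐ c ∂PΦ, c.IsSimple)
    (H : Measure ℝ≥0) [IsProbabilityMeasure H] {n k : ℕ} (hn : 1 ≤ n) {σ : Fin n → Fin k}
    (hσ : Function.Surjective σ) [SFinite (momentMeasure PΦ k)]
    {Q : Kernel (Fin k → E) (Config E)} [IsMarkovKernel Q] (hQ : IsReducedPalm PΦ k Q) :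
    ∀ᵐ x ∂(momentMeasure PΦ k), ∫⁻ u, latentWeight H Q σ x u ≠ ∞ := by
  have h := setLIntegral_map_sampleLaw hΦ H hn hσ hQ (g := fun _ => 1) measurable_const
  have hG : (ENNReal.ofReal (Real.Gamma n))⁻¹ ≠ 0 := by simp
  have hfin : ∫⁻ y in pattern E σ, 1 ∂((sampleLaw PΦ H n n).map Prod.fst) ≠ ∞ := by
    simp
  rw [h] at hfin
  have h2 : ∫⁻ x, 1 * (∫⁻ u, latentWeight H Q σ x u) ∂(momentMeasure PΦ k) ≠ ∞ :=
    fun e => hfin (by rw [e, ENNReal.mul_top hG])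
  simp only [one_mul] at h2
  have hW : Measurable fun x => ∫⁻ u, latentWeight H Q σ x u :=
    (measurable_latentWeight H Q σ).lintegral_prod_right'
  filter_upwards [ae_lt_top hW h2] with x hx using hx.ne

/-- Disintegration of the weighted moment measure by the law of the sample and the latent
density; `s` recovers the distinct values of a sample with pattern `σ`. -/
theorem setLIntegral_map_sampleLaw_latentDensity {E : Type*} [MeasurableSpace E] [MeasurableEq E]
    {PΦ : Measure (Config E)} [IsProbabilityMeasure PΦ] (hΦ : ∀ᵐ c ∂PΦ, c.IsSimple)
    (H : Measure ℝ≥0) [IsProbabilityMeasure H] {n k : ℕ} (hn : 1 ≤ n) {σ : Fin n → Fin k}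
    {s : Fin k → Fin n} (hs : Function.RightInverse s σ) [SFinite (momentMeasure PΦ k)]
    {Q : Kernel (Fin k → E) (Config E)} [IsMarkovKernel Q] (hQ : IsReducedPalm PΦ k Q)
    {h : (Fin n → E) × ℝ → ℝ≥0∞} (hh : Measurable h) :
    ∫⁻ y in pattern E σ, (∫⁻ u, h (y, u) * latentDensity H Q σ (y ∘ s) u)
        ∂((sampleLaw PΦ H n n).map Prod.fst)
      = (ENNReal.ofReal (Real.Gamma n))⁻¹ *
          ∫⁻ x, (∫⁻ u, h (x ∘ σ, u) * latentWeight H Q σ x u) ∂(momentMeasure PΦ k) := by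
  have hD := measurable_latentDensity H Q σ
  have hcomp : Measurable fun y : Fin n → E => y ∘ s := by fun_prop
  have hm : Measurable fun p : (Fin n → E) × ℝ => h p * latentDensity H Q σ (p.1 ∘ s) p.2 :=
    hh.mul (hD.comp ((hcomp.comp measurable_fst).prodMk measurable_snd))
  rw [setLIntegral_map_sampleLaw hΦ H hn hs.surjective hQ hm.lintegral_prod_right']
  congr 1
  refine lintegral_congr_ae ?_
  filter_upwards [ae_lintegral_latentWeight_ne_top hΦ H hn hs.surjective hQ] with x hx
  have hxs : (x ∘ σ) ∘ s = x := by ext l; simp [hs l]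
  rw [hxs, mul_comm]
  exact lintegral_mul_latentDensity H Q σ x hx (hh.comp (measurable_prodMk_left (x := x ∘ σ)))

/-- The conditional law of `U_n` given the sample. -/
theorem condDistrib_latent {E : Type*} [MeasurableSpace E] [MeasurableEq E]
    {PΦ : Measure (Config E)} [IsProbabilityMeasure PΦ] (hΦ : ∀ᵐ c ∂PΦ, c.IsSimple)
    (H : Measure ℝ≥0) [IsProbabilityMeasure H] {n k : ℕ} (hn : 1 ≤ n) {σ : Fin n → Fin k}
    {s : Fin k → Fin n} (hs : Function.RightInverse s σ) [SFinite (momentMeasure PΦ k)]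
    {Q : Kernel (Fin k → E) (Config E)} [IsMarkovKernel Q] (hQ : IsReducedPalm PΦ k Q) :
    ∀ᵐ ω ∂(sampleLaw PΦ H n n), ω.1 ∈ pattern E σ →
      condDistrib (fun ω => ω.2) (fun ω => ω.1) (sampleLaw PΦ H n n) ω.1
        = volume.withDensity (latentDensity H Q σ (ω.1 ∘ s)) := by
  have hD : Measurable fun p : (Fin n → E) × ℝ => latentDensity H Q σ (p.1 ∘ s) p.2 := by
    have hcomp : Measurable fun y : Fin n → E => y ∘ s := by fun_prop
    exact (measurable_latentDensity H Q σ).comp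
      ((hcomp.comp measurable_fst).prodMk measurable_snd)
  refine condDistrib_ae_eq_on (Y := fun ω : (Fin n → E) × ℝ => ω.1) (Z := fun ω => ω.2)
    (K := fun y => volume.withDensity (latentDensity H Q σ (y ∘ s)))
    measurable_fst measurable_snd (measurableSet_pattern hs.surjective) ?_ ?_
  · refine Measure.measurable_of_measurable_coe _ fun C hC => ?_
    simp only [withDensity_apply _ hC]
    exact hD.lintegral_prod_right'
  · intro F hF
    refine Eq.trans ?_ (setLIntegral_sampleLaw_pattern hΦ H hn hs.surjective hQ hF).symm
    rw [← setLIntegral_map_sampleLaw_latentDensity hΦ H hn hs hQ hF]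
    refine lintegral_congr fun y => ?_
    have hDy : Measurable (latentDensity H Q σ (y ∘ s)) :=
      hD.comp (measurable_prodMk_left (x := y))
    have hFy : Measurable fun u => F (y, u) := hF.comp (measurable_prodMk_left (x := y))
    rw [lintegral_withDensity_eq_lintegral_mul _ hDy hFy]
    simp only [Pi.mul_apply, mul_comm]

/-! ### The first observations of a larger sample -/

theorem measurable_init {E : Type*} [MeasurableSpace E] (n : ℕ) :
    Measurable fun z : Fin (n + 1) → E => (Fin.init z : Fin n → E) :=
  measurable_pi_lambda _ fun i => measurable_pi_apply i.castSucc

theorem map_init_pi {E : Type*} [MeasurableSpace E] (μ : Measure E) [IsProbabilityMeasure μ]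
    (n : ℕ) : (Measure.pi fun _ : Fin (n + 1) => μ).map (fun z => (Fin.init z : Fin n → E))
      = Measure.pi fun _ => μ := by
  symm
  refine Measure.pi_eq fun t ht => ?_
  rw [Measure.map_apply (measurable_init n) (.univ_pi ht)]
  have : (fun z : Fin (n + 1) → E => (Fin.init z : Fin n → E)) ⁻¹' (Set.univ.pi t)
      = Set.univ.pi (Fin.snoc (α := fun _ => Set E) t Set.univ) := by
    ext z
    simp [Fin.forall_fin_succ', Fin.init]
  rw [this, Measure.pi_pi, Fin.prod_univ_castSucc]
  simp

/-- If the total mass is positive, the last draw and the gamma variable integrate to one whatever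
the shape. If it is zero, both samples carry no mass because `n ≥ 1`. -/
theorem map_init_sampleLaw {E : Type*} [MeasurableSpace E] (PΦ : Measure (Config E))
    (H : Measure ℝ≥0) {n : ℕ} (hn : 1 ≤ n) :
    (sampleLaw PΦ H (n + 1) (n + 1)).map (fun ω => (Fin.init ω.1 : Fin n → E))
      = (sampleLaw PΦ H n n).map Prod.fst := by
  have hi : Measurable fun ω : (Fin (n + 1) → E) × ℝ => (Fin.init ω.1 : Fin n → E) :=
    (measurable_init n).comp measurable_fst
  have hK := measurable_sampleKernel (E := E) hn
  have hK' := measurable_sampleKernel (E := E) (n := n + 1) (by omega)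
  ext B hB
  rw [Measure.map_apply hi hB, Measure.map_apply measurable_fst hB, sampleLaw, sampleLaw,
    Measure.bind_apply (hi hB) hK'.aemeasurable,
    Measure.bind_apply (measurable_fst hB) hK.aemeasurable]
  refine lintegral_congr fun ω => ?_
  have hT : (randomMeasure ω Set.univ).toReal = (total ω : ℝ) := by
    rw [randomMeasure_univ]; rfl
  rcases eq_or_ne (total ω) 0 with h | h
  · simp only [pi_normalized_of_total_eq_zero h hn,
      pi_normalized_of_total_eq_zero h (show 1 ≤ n + 1 by omega), Measure.zero_prod]
    simp
  · have hpos : (0 : ℝ) < total ω := by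
      exact_mod_cast pos_iff_ne_zero.2 h
    have h1 : IsProbabilityMeasure (normalized ω) := ⟨by
      rw [normalized, Measure.smul_apply, smul_eq_mul, randomMeasure_univ]
      exact ENNReal.inv_mul_cancel (by exact_mod_cast h) ENNReal.coe_ne_top⟩
    have h2 := isProbabilityMeasure_gammaMeasure (a := (n : ℝ)) (by exact_mod_cast hn) hpos
    have h3 := isProbabilityMeasure_gammaMeasure (a := ((n + 1 : ℕ) : ℝ)) (by positivity) hpos
    have e : (fun ω : (Fin (n + 1) → E) × ℝ => (Fin.init ω.1 : Fin n → E)) ⁻¹' B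
        = ((fun z : Fin (n + 1) → E => (Fin.init z : Fin n → E)) ⁻¹' B) ×ˢ Set.univ := by
      ext; simp
    have e' : (Prod.fst : (Fin n → E) × ℝ → (Fin n → E)) ⁻¹' B = B ×ˢ Set.univ := by
      ext; simp
    rw [hT, e, e', Measure.prod_prod, Measure.prod_prod, measure_univ, measure_univ,
      ← Measure.map_apply (measurable_init n) hB, map_init_pi]

/-! ### The predictive measure -/

/-- The density of `newPart` with respect to `P₀`. -/
noncomputable def newDensity {E : Type*} [MeasurableSpace E] {k : ℕ} (PΦ : Measure (Config E))
    (H : Measure ℝ≥0) (P₀ : Measure E) (Q : Kernel (Fin k → E) (Config E))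
    (Q' : Kernel (Fin (k + 1) → E) (Config E)) (x : Fin k → E) (u : ℝ) (y : E) : ℝ≥0∞ :=
  kappa H u 1
    * (laplace (Q' (Fin.snoc (α := fun _ => E) x y)) H (fun _ => u)
        / laplace (Q x) H (fun _ => u))
    * (momentDensity PΦ P₀ (k + 1) (Fin.snoc (α := fun _ => E) x y) / momentDensity PΦ P₀ k x)

theorem newPart_eq {E : Type*} [MeasurableSpace E] {k : ℕ} (PΦ : Measure (Config E))
    (H : Measure ℝ≥0) (P₀ : Measure E) (Q : Kernel (Fin k → E) (Config E))
    (Q' : Kernel (Fin (k + 1) → E) (Config E)) (x : Fin k → E) (u : ℝ) :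
    newPart PΦ H P₀ Q Q' x u = P₀.withDensity (newDensity PΦ H P₀ Q Q' x u) := rfl

theorem measurable_newDensity {E : Type*} [MeasurableSpace E] {k : ℕ} (PΦ : Measure (Config E))
    (H : Measure ℝ≥0) [IsProbabilityMeasure H] (P₀ : Measure E)
    (Q : Kernel (Fin k → E) (Config E)) [IsMarkovKernel Q]
    (Q' : Kernel (Fin (k + 1) → E) (Config E)) [IsMarkovKernel Q'] :
    Measurable fun p : ((Fin k → E) × ℝ) × E =>
      newDensity PΦ H P₀ Q Q' p.1.1 p.1.2 p.2 := by
  have hs : Measurable fun p : ((Fin k → E) × ℝ) × E => Fin.snoc (α := fun _ => E) p.1.1 p.2 :=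
    (measurable_snoc k).comp ((measurable_fst.comp measurable_fst).prodMk measurable_snd)
  have hL : Measurable fun p : ((Fin k → E) × ℝ) × E => laplace (Q p.1.1) H (fun _ => p.1.2) :=
    (measurable_laplace Q H).comp measurable_fst
  have hL' : Measurable fun p : ((Fin k → E) × ℝ) × E =>
      laplace (Q' (Fin.snoc (α := fun _ => E) p.1.1 p.2)) H (fun _ => p.1.2) :=
    (measurable_laplace Q' H).comp (hs.prodMk (measurable_snd.comp measurable_fst))
  unfold newDensity
  fun_prop

@[fun_prop]
theorem measurable_oldWeight {n k : ℕ} (H : Measure ℝ≥0) [SFinite H] (σ : Fin n → Fin k)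
    (j : Fin k) : Measurable fun u => oldWeight H σ u j := by
  unfold oldWeight; fun_prop

theorem lintegral_predictive {E : Type*} [MeasurableSpace E] {n k : ℕ} (PΦ : Measure (Config E))
    (H : Measure ℝ≥0) [IsProbabilityMeasure H] (P₀ : Measure E)
    (Q : Kernel (Fin k → E) (Config E)) [IsMarkovKernel Q]
    (Q' : Kernel (Fin (k + 1) → E) (Config E)) [IsMarkovKernel Q'] (σ : Fin n → Fin k)
    (x : Fin k → E) (u : ℝ) {f : E → ℝ≥0∞} (hf : Measurable f) :
    ∫⁻ y, f y ∂(predictive PΦ H P₀ Q Q' σ x u)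
      = ∑ j, oldWeight H σ u j * f (x j) + ∫⁻ y, newDensity PΦ H P₀ Q Q' x u y * f y ∂P₀ := by
  have hd : Measurable fun y => newDensity PΦ H P₀ Q Q' x u y := by
    have hm : Measurable fun y : E => ((x, u), y) := measurable_prodMk_left
    have h := (measurable_newDensity PΦ H P₀ Q Q').comp hm
    exact h
  rw [predictive, lintegral_add_measure, lintegral_finsetSum_measure, newPart_eq,
    lintegral_withDensity_eq_lintegral_mul _ hd hf]
  simp only [lintegral_smul_measure, lintegral_dirac' _ hf, smul_eq_mul, Pi.mul_apply]

theorem measurable_lintegral_predictive {E α : Type*} [MeasurableSpace E] [MeasurableSpace α]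
    {n k : ℕ} (PΦ : Measure (Config E)) (H : Measure ℝ≥0) [IsProbabilityMeasure H]
    (P₀ : Measure E) [SFinite P₀] (Q : Kernel (Fin k → E) (Config E)) [IsMarkovKernel Q]
    (Q' : Kernel (Fin (k + 1) → E) (Config E)) [IsMarkovKernel Q'] (σ : Fin n → Fin k)
    {X : α → Fin k → E} (hX : Measurable X) {U : α → ℝ} (hU : Measurable U)
    {f : α × E → ℝ≥0∞} (hf : Measurable f) :
    Measurable fun a => ∫⁻ y, f (a, y) ∂(predictive PΦ H P₀ Q Q' σ (X a) (U a)) := by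
  have h1 : ∀ a, Measurable fun y => f (a, y) := fun a => hf.comp measurable_prodMk_left
  simp only [fun a => lintegral_predictive PΦ H P₀ Q Q' σ (X a) (U a) (f := fun y => f (a, y))
    (h1 a)]
  have hd : Measurable fun p : α × E => newDensity PΦ H P₀ Q Q' (X p.1) (U p.1) p.2 := by
    have hm : Measurable fun p : α × E => ((X p.1, U p.1), p.2) := by fun_prop
    have h := (measurable_newDensity PΦ H P₀ Q Q').comp hm
    exact h
  have h2 : Measurable fun a => ∫⁻ y, newDensity PΦ H P₀ Q Q' (X a) (U a) y * f (a, y) ∂P₀ :=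
    (hd.mul hf).lintegral_prod_right'
  have h3 : ∀ j, Measurable fun a => f (a, X a j) := fun j => by fun_prop
  have h4 : ∀ j, Measurable fun a => oldWeight H σ (U a) j := fun j =>
    (measurable_oldWeight H σ j).comp hU
  fun_prop

/-! ### The patterns of a sample extended by one observation -/

theorem mem_pattern_joinOld {E : Type*} {n k : ℕ} {σ : Fin n → Fin k} {j : Fin k}
    {y : Fin (n + 1) → E} : y ∈ pattern E (joinOld σ j) ↔
      ∃ x : Fin k → E, Function.Injective x ∧ Fin.init y = x ∘ σ ∧ y (Fin.last n) = x j := by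
  refine exists_congr fun x => and_congr_right fun _ => ?_
  simp [funext_iff, Fin.forall_fin_succ', joinOld, Fin.init]

theorem mem_pattern_joinNew {E : Type*} {n k : ℕ} {σ : Fin n → Fin k} {y : Fin (n + 1) → E} :
    y ∈ pattern E (joinNew σ) ↔ ∃ x : Fin k → E, Function.Injective x ∧
      Fin.init y = x ∘ σ ∧ ∀ j, y (Fin.last n) ≠ x j := by
  constructor
  · rintro ⟨z, hz, rfl⟩
    refine ⟨z ∘ Fin.castSucc, hz.comp (Fin.castSucc_injective k), ?_, fun j => ?_⟩
    · ext i; simp [Fin.init, joinNew]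
    · simp [joinNew, hz.eq_iff, (Fin.castSucc_ne_last j).symm]
  · rintro ⟨x, hx, h1, h2⟩
    refine ⟨Fin.snoc (α := fun _ => E) x (y (Fin.last n)), ?_, ?_⟩
    · rw [Fin.snoc_injective_iff]
      exact ⟨hx, by rintro ⟨j, hj⟩; exact h2 j hj.symm⟩
    · ext i
      refine Fin.lastCases ?_ (fun i => ?_) i
      · simp [joinNew]
      · simpa [joinNew, Fin.init] using congrFun h1 i

theorem init_preimage_pattern {E : Type*} {n k : ℕ} (σ : Fin n → Fin k) :
    (fun z : Fin (n + 1) → E => (Fin.init z : Fin n → E)) ⁻¹' pattern E σ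
      = (⋃ j ∈ Finset.univ, pattern E (joinOld σ j)) ∪ pattern E (joinNew σ) := by
  ext y
  simp only [Finset.mem_univ, Set.iUnion_true, Set.mem_union, Set.mem_iUnion, mem_pattern_joinOld,
    mem_pattern_joinNew]
  constructor
  · rintro ⟨x, hx, h⟩
    by_cases hy : ∃ j, y (Fin.last n) = x j
    · obtain ⟨j, hj⟩ := hy
      exact Or.inl ⟨j, x, hx, h, hj⟩
    · exact Or.inr ⟨x, hx, h, not_exists.1 hy⟩
  · rintro (⟨j, x, hx, h, -⟩ | ⟨x, hx, h, -⟩) <;> exact ⟨x, hx, h⟩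

/-- As `σ` is onto, the first `n` observations determine the distinct values, and injectivity of
these determines which one the last observation equals. -/
theorem disjoint_pattern_joinOld {E : Type*} {n k : ℕ} {σ : Fin n → Fin k}
    (hσ : Function.Surjective σ) {i j : Fin k} (hij : i ≠ j) :
    Disjoint (pattern E (joinOld σ i)) (pattern E (joinOld σ j)) := by
  refine Set.disjoint_left.2 fun y hy hy' => ?_
  obtain ⟨x, hx, h, hl⟩ := mem_pattern_joinOld.1 hy
  obtain ⟨x', -, h', hl'⟩ := mem_pattern_joinOld.1 hy'
  obtain rfl := hσ.injective_comp_right (h.symm.trans h')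
  exact hij (hx (hl.symm.trans hl'))

theorem disjoint_pattern_joinOld_joinNew {E : Type*} {n k : ℕ} {σ : Fin n → Fin k}
    (hσ : Function.Surjective σ) (j : Fin k) :
    Disjoint (pattern E (joinOld σ j)) (pattern E (joinNew σ)) := by
  refine Set.disjoint_left.2 fun y hy hy' => ?_
  obtain ⟨x, -, h, hl⟩ := mem_pattern_joinOld.1 hy
  obtain ⟨x', -, h', hl'⟩ := mem_pattern_joinNew.1 hy'
  obtain rfl := hσ.injective_comp_right (h.symm.trans h')
  exact hl' j hl

theorem setLIntegral_init_preimage_pattern {E : Type*} [MeasurableSpace E] [MeasurableEq E]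
    {n k : ℕ} {σ : Fin n → Fin k} (hσ : Function.Surjective σ)
    (μ : Measure ((Fin (n + 1) → E) × ℝ)) (F : (Fin (n + 1) → E) × ℝ → ℝ≥0∞) :
    ∫⁻ p in (fun p => Fin.init p.1) ⁻¹' pattern E σ, F p ∂μ
      = ∑ j, ∫⁻ p in Prod.fst ⁻¹' pattern E (joinOld σ j), F p ∂μ
        + ∫⁻ p in Prod.fst ⁻¹' pattern E (joinNew σ), F p ∂μ := by
  have hold : ∀ j, MeasurableSet ((Prod.fst : (Fin (n + 1) → E) × ℝ → _) ⁻¹'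
      pattern E (joinOld σ j)) := fun j =>
    measurable_fst (measurableSet_pattern (joinOld_surjective hσ j))
  have hnew : MeasurableSet ((Prod.fst : (Fin (n + 1) → E) × ℝ → _) ⁻¹' pattern E (joinNew σ)) :=
    measurable_fst (measurableSet_pattern (joinNew_surjective hσ))
  have hset : (fun p : (Fin (n + 1) → E) × ℝ => (Fin.init p.1 : Fin n → E)) ⁻¹' pattern E σ
      = (⋃ j ∈ Finset.univ, (Prod.fst : (Fin (n + 1) → E) × ℝ → _) ⁻¹' pattern E (joinOld σ j))
        ∪ Prod.fst ⁻¹' pattern E (joinNew σ) := by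
    have := congrArg (fun s => (Prod.fst : (Fin (n + 1) → E) × ℝ → _) ⁻¹' s)
      (init_preimage_pattern (E := E) σ)
    simp only [Set.preimage_union, Set.preimage_iUnion] at this
    exact this
  rw [hset, lintegral_union hnew, lintegral_biUnion_finset _ fun j _ => hold j]
  · exact fun i _ j _ hij => (disjoint_pattern_joinOld hσ hij).preimage _
  · simp only [Finset.mem_univ, Set.iUnion_true, Set.disjoint_iUnion_left]
    exact fun j => (disjoint_pattern_joinOld_joinNew hσ j).preimage _

/-- The recursion `Γ(n+1) = n Γ(n)` is the source of the factor `u / n` in the joint law. -/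
theorem inv_gamma_mul_ofReal {n : ℕ} (hn : 1 ≤ n) (u : ℝ) :
    (ENNReal.ofReal (Real.Gamma n))⁻¹ * ENNReal.ofReal (u / n)
      = (ENNReal.ofReal (Real.Gamma (n + 1 : ℕ)))⁻¹ * ENNReal.ofReal u := by
  have hn' : (0 : ℝ) < n := by exact_mod_cast hn
  have hG : 0 < Real.Gamma n := Real.Gamma_pos_of_pos hn'
  rw [Nat.cast_succ, Real.Gamma_add_one hn'.ne', ENNReal.ofReal_mul hn'.le,
    ENNReal.ofReal_div_of_pos hn', div_eq_mul_inv,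
    ENNReal.mul_inv (Or.inr ENNReal.ofReal_ne_top) (Or.inl ENNReal.ofReal_ne_top)]
  ring

/-! ### The joint law of a new observation and the auxiliary variable -/

/-- The triple `(Y_1, …, Y_n)`, `Y_{n+1}`, `U`. -/
def splitLast {E : Type*} {n : ℕ} (p : (Fin (n + 1) → E) × ℝ) : (Fin n → E) × (E × ℝ) :=
  (Fin.init p.1, (p.1 (Fin.last n), p.2))

@[fun_prop]
theorem measurable_splitLast {E : Type*} [MeasurableSpace E] {n : ℕ} :
    Measurable (splitLast : (Fin (n + 1) → E) × ℝ → (Fin n → E) × (E × ℝ)) :=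
  ((measurable_init n).comp measurable_fst).prodMk
    (((measurable_pi_apply _).comp measurable_fst).prodMk measurable_snd)

theorem setLIntegral_joinOld {E : Type*} [MeasurableSpace E] [MeasurableEq E]
    {PΦ : Measure (Config E)} [IsProbabilityMeasure PΦ] (hΦ : ∀ᵐ c ∂PΦ, c.IsSimple)
    (H : Measure ℝ≥0) [IsProbabilityMeasure H]
    {n k : ℕ} (hn : 1 ≤ n) {σ : Fin n → Fin k} (hσ : Function.Surjective σ)
    [SFinite (momentMeasure PΦ k)]
    {Q : Kernel (Fin k → E) (Config E)} [IsMarkovKernel Q] (hQ : IsReducedPalm PΦ k Q)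
    (j : Fin k) {F : (Fin n → E) × (E × ℝ) → ℝ≥0∞} (hF : Measurable F) :
    ∫⁻ p in Prod.fst ⁻¹' pattern E (joinOld σ j), F (splitLast p)
        ∂(sampleLaw PΦ H (n + 1) (n + 1))
      = ∫⁻ x, (∫⁻ u, oldWeight H σ u j * F (x ∘ σ, (x j, u))
            * ((ENNReal.ofReal (Real.Gamma (n + 1 : ℕ)))⁻¹ * ENNReal.ofReal u
              * latentWeight H Q σ x u)) ∂(momentMeasure PΦ k) := by
  have hW := measurable_latentWeight H Q (joinOld σ j)
  have hS : Measurable fun p : (Fin k → E) × ℝ => splitLast (p.1 ∘ joinOld σ j, p.2) := by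
    have : Measurable fun x : Fin k → E => x ∘ joinOld σ j := by fun_prop
    fun_prop
  have hm : Measurable fun p : (Fin k → E) × ℝ => F (splitLast (p.1 ∘ joinOld σ j, p.2))
      * latentWeight H Q (joinOld σ j) p.1 p.2 := (hF.comp hS).mul hW
  rw [setLIntegral_sampleLaw_pattern hΦ H (by omega) (joinOld_surjective hσ j) hQ
    (F := fun p => F (splitLast p)) (hF.comp measurable_splitLast),
    ← lintegral_const_mul _ hm.lintegral_prod_right']
  refine lintegral_congr fun x => ?_
  have hmx : Measurable fun u => F (splitLast (x ∘ joinOld σ j, u))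
      * latentWeight H Q (joinOld σ j) x u := by
    have h := hm.comp (measurable_prodMk_left (x := x))
    exact h
  dsimp only
  rw [← lintegral_const_mul _ hmx]
  refine lintegral_congr fun u => ?_
  have h1 : splitLast (x ∘ joinOld σ j, u) = (x ∘ σ, (x j, u)) := by
    simp only [splitLast, Prod.mk.injEq, Function.comp_apply, joinOld, Fin.snoc_last, and_true]
    ext i; simp [Fin.init]
  rw [latentWeight_joinOld hn H Q hσ, h1]
  ring

/-- A pattern with `k + 1` values is integrated against `M_{k+1}`. Its disintegration isolates the
new value `y`, and the density ratio and the extra factors of the latent weight combine into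
`newDensity`. -/
theorem setLIntegral_joinNew {E : Type*} [MeasurableSpace E] [MeasurableEq E]
    {PΦ : Measure (Config E)} [IsProbabilityMeasure PΦ] (hΦ : ∀ᵐ c ∂PΦ, c.IsSimple)
    (H : Measure ℝ≥0) [IsProbabilityMeasure H] {P₀ : Measure E} [SigmaFinite P₀] {n k : ℕ}
    (hn : 1 ≤ n) {σ : Fin n → Fin k} {s : Fin k → Fin n} (hs : Function.RightInverse s σ)
    [SigmaFinite (momentMeasure PΦ k)] [SigmaFinite (momentMeasure PΦ (k + 1))]
    (hk : momentMeasure PΦ k ≪ Measure.pi fun _ => P₀)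
    (hk' : momentMeasure PΦ (k + 1) ≪ Measure.pi fun _ => P₀)
    {Q : Kernel (Fin k → E) (Config E)} [IsMarkovKernel Q]
    {Q' : Kernel (Fin (k + 1) → E) (Config E)} [IsMarkovKernel Q']
    (hQ' : IsReducedPalm PΦ (k + 1) Q')
    {F : (Fin n → E) × (E × ℝ) → ℝ≥0∞} (hF : Measurable F) :
    ∫⁻ p in Prod.fst ⁻¹' pattern E (joinNew σ), F (splitLast p)
        ∂(sampleLaw PΦ H (n + 1) (n + 1))
      = ∫⁻ x, (∫⁻ u, (∫⁻ y, newDensity PΦ H P₀ Q Q' x u y * F (x ∘ σ, (y, u)) ∂P₀)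
            * ((ENNReal.ofReal (Real.Gamma (n + 1 : ℕ)))⁻¹ * ENNReal.ofReal u
              * latentWeight H Q σ x u)) ∂(momentMeasure PΦ k) := by
  have hW := measurable_latentWeight H Q' (joinNew σ)
  have hS : Measurable fun p : (Fin (k + 1) → E) × ℝ => splitLast (p.1 ∘ joinNew σ, p.2) := by
    have : Measurable fun x : Fin (k + 1) → E => x ∘ joinNew σ := by fun_prop
    fun_prop
  have hm : Measurable fun p : (Fin (k + 1) → E) × ℝ => F (splitLast (p.1 ∘ joinNew σ, p.2))
      * latentWeight H Q' (joinNew σ) p.1 p.2 := (hF.comp hS).mul hW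
  rw [setLIntegral_sampleLaw_pattern hΦ H (by omega) (joinNew_surjective hs.surjective) hQ'
    (F := fun p => F (splitLast p)) (hF.comp measurable_splitLast),
    ← lintegral_const_mul _ hm.lintegral_prod_right',
    lintegral_momentMeasure_succ hk hk' (hm.lintegral_prod_right'.const_mul _)]
  refine lintegral_congr fun x => ?_
  have hd := measurable_newDensity PΦ H P₀ Q Q'
  have hN : Measurable fun p : E × ℝ => newDensity PΦ H P₀ Q Q' x p.2 p.1 := by
    have h1 : Measurable fun p : E × ℝ => ((x, p.2), p.1) := by fun_prop
    have h2 := hd.comp h1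
    exact h2
  have hFx : Measurable fun p : E × ℝ => F (x ∘ σ, (p.1, p.2)) := by fun_prop
  have hWx : Measurable fun u => latentWeight H Q σ x u := by
    have h := (measurable_latentWeight H Q σ).comp (measurable_prodMk_left (x := x))
    exact h
  have hNF : Measurable fun p : E × ℝ => newDensity PΦ H P₀ Q Q' x p.2 p.1
      * F (x ∘ σ, (p.1, p.2)) * ((ENNReal.ofReal (Real.Gamma (n + 1 : ℕ)))⁻¹ * ENNReal.ofReal p.2
              * latentWeight H Q σ x p.2) := by fun_prop
  have hr : ∀ u, (∫⁻ y, newDensity PΦ H P₀ Q Q' x u y * F (x ∘ σ, (y, u)) ∂P₀)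
            * ((ENNReal.ofReal (Real.Gamma (n + 1 : ℕ)))⁻¹ * ENNReal.ofReal u
              * latentWeight H Q σ x u)
      = ∫⁻ y, newDensity PΦ H P₀ Q Q' x u y * F (x ∘ σ, (y, u))
          * ((ENNReal.ofReal (Real.Gamma (n + 1 : ℕ)))⁻¹ * ENNReal.ofReal u
              * latentWeight H Q σ x u) ∂P₀ := fun u => by
    have h := (hN.mul hFx).comp (measurable_prodMk_right (y := u))
    exact (lintegral_mul_const _ h).symm
  simp only [hr]
  -- The disintegration puts the integral over `y` outside that over `u`, while the predictive
  -- measure needs it inside; Tonelli exchanges them.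
  rw [← lintegral_lintegral_swap hNF.aemeasurable]
  refine lintegral_congr fun y => ?_
  have hmx : Measurable fun u => F (splitLast (Fin.snoc (α := fun _ => E) x y ∘ joinNew σ, u))
      * latentWeight H Q' (joinNew σ) (Fin.snoc (α := fun _ => E) x y) u := by
    have h := hm.comp (measurable_prodMk_left (x := Fin.snoc (α := fun _ => E) x y))
    exact h
  rw [← lintegral_const_mul _ hmx, ← lintegral_const_mul _ (hmx.const_mul _)]
  refine lintegral_congr fun u => ?_
  have h1 : splitLast ((Fin.snoc (α := fun _ => E) x y) ∘ joinNew σ, u) = (x ∘ σ, (y, u)) := by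
    simp only [splitLast, Prod.mk.injEq, Function.comp_apply, joinNew, Fin.snoc_last, and_true]
    ext i; simp [Fin.init]
  rw [latentWeight_joinNew hn H Q, h1, newDensity]
  ring

/-- The joint law of `(Y_1, …, Y_n)`, `Y_{n+1}` and `U` on the event that the first `n`
observations have the pattern `σ`. -/
theorem setLIntegral_splitLast {E : Type*} [MeasurableSpace E] [MeasurableEq E]
    {PΦ : Measure (Config E)} [IsProbabilityMeasure PΦ] (hΦ : ∀ᵐ c ∂PΦ, c.IsSimple)
    (H : Measure ℝ≥0) [IsProbabilityMeasure H] {P₀ : Measure E} [SigmaFinite P₀] {n k : ℕ}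
    (hn : 1 ≤ n) {σ : Fin n → Fin k} {s : Fin k → Fin n} (hs : Function.RightInverse s σ)
    [SigmaFinite (momentMeasure PΦ k)] [SigmaFinite (momentMeasure PΦ (k + 1))]
    (hk : momentMeasure PΦ k ≪ Measure.pi fun _ => P₀)
    (hk' : momentMeasure PΦ (k + 1) ≪ Measure.pi fun _ => P₀)
    {Q : Kernel (Fin k → E) (Config E)} [IsMarkovKernel Q] (hQ : IsReducedPalm PΦ k Q)
    {Q' : Kernel (Fin (k + 1) → E) (Config E)} [IsMarkovKernel Q']
    (hQ' : IsReducedPalm PΦ (k + 1) Q')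
    {F : (Fin n → E) × (E × ℝ) → ℝ≥0∞} (hF : Measurable F) :
    ∫⁻ p in (fun p => Fin.init p.1) ⁻¹' pattern E σ, F (splitLast p)
        ∂(sampleLaw PΦ H (n + 1) (n + 1))
      = ∫⁻ y in pattern E σ, (∫⁻ u,
          (∫⁻ z, F (y, (z, u)) ∂(predictive PΦ H P₀ Q Q' σ (y ∘ s) u)) * ENNReal.ofReal (u / n)
            * latentDensity H Q σ (y ∘ s) u) ∂((sampleLaw PΦ H n n).map Prod.fst) := by
  have hcomp : Measurable fun y : Fin n → E => y ∘ s := by fun_prop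
  have hp : Measurable fun p : (Fin n → E) × ℝ =>
      ∫⁻ z, F (p.1, (z, p.2)) ∂(predictive PΦ H P₀ Q Q' σ (p.1 ∘ s) p.2) :=
    measurable_lintegral_predictive PΦ H P₀ Q Q' σ (hcomp.comp measurable_fst) measurable_snd
      (f := fun q : ((Fin n → E) × ℝ) × E => F (q.1.1, (q.2, q.1.2))) (by fun_prop)
  have hh : Measurable fun p : (Fin n → E) × ℝ =>
      (∫⁻ z, F (p.1, (z, p.2)) ∂(predictive PΦ H P₀ Q Q' σ (p.1 ∘ s) p.2))
        * ENNReal.ofReal (p.2 / n) := by fun_prop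
  have hW := measurable_latentWeight H Q σ
  have hcσ : Measurable fun x : Fin k → E => x ∘ σ := by fun_prop
  have hO : ∀ j, Measurable fun p : (Fin k → E) × ℝ =>
      oldWeight H σ p.2 j * F (p.1 ∘ σ, (p.1 j, p.2))
        * ((ENNReal.ofReal (Real.Gamma (n + 1 : ℕ)))⁻¹ * ENNReal.ofReal p.2
          * latentWeight H Q σ p.1 p.2) := fun j => by fun_prop
  have hcs : ∀ x : Fin k → E, (x ∘ σ) ∘ s = x := fun x => by ext l; simp [hs l]
  rw [setLIntegral_init_preimage_pattern hs.surjective,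
    setLIntegral_map_sampleLaw_latentDensity hΦ H hn hs hQ hh,
    setLIntegral_joinNew hΦ H hn hs hk hk' hQ' hF (Q := Q)]
  simp only [setLIntegral_joinOld hΦ H hn hs.surjective hQ _ hF, hcs]
  have hW' : Measurable fun p : (Fin k → E) × ℝ =>
      ((∫⁻ z, F (p.1 ∘ σ, (z, p.2)) ∂(predictive PΦ H P₀ Q Q' σ p.1 p.2))
        * ENNReal.ofReal (p.2 / n)) * latentWeight H Q σ p.1 p.2 := by
    have := measurable_lintegral_predictive PΦ H P₀ Q Q' σ (α := (Fin k → E) × ℝ) measurable_fst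
      measurable_snd (f := fun q : ((Fin k → E) × ℝ) × E => F (q.1.1 ∘ σ, (q.2, q.1.2)))
      (by fun_prop)
    fun_prop
  rw [← lintegral_const_mul _ hW'.lintegral_prod_right',
    ← lintegral_finsetSum _ fun j _ => (hO j).lintegral_prod_right',
    ← lintegral_add_left (Finset.measurable_fun_sum _ fun j _ => (hO j).lintegral_prod_right')]
  refine lintegral_congr fun x => ?_
  have hOx : ∀ j, Measurable fun u =>
      oldWeight H σ u j * F (x ∘ σ, (x j, u))
        * ((ENNReal.ofReal (Real.Gamma (n + 1 : ℕ)))⁻¹ * ENNReal.ofReal u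
          * latentWeight H Q σ x u) := fun j => by
    have h := (hO j).comp (measurable_prodMk_left (x := x))
    exact h
  have hWx : Measurable fun u =>
      ((∫⁻ z, F (x ∘ σ, (z, u)) ∂(predictive PΦ H P₀ Q Q' σ x u))
        * ENNReal.ofReal (u / n)) * latentWeight H Q σ x u := by
    have h := hW'.comp (measurable_prodMk_left (x := x))
    exact h
  dsimp only
  rw [← lintegral_const_mul _ hWx, ← lintegral_finsetSum _ fun j _ => hOx j,
    ← lintegral_add_left (Finset.measurable_fun_sum _ fun j _ => hOx j)]
  refine lintegral_congr fun u => ?_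
  have hFu : Measurable fun z => F (x ∘ σ, (z, u)) := by fun_prop
  rw [lintegral_predictive PΦ H P₀ Q Q' σ x u hFu, ← inv_gamma_mul_ofReal hn u, ← Finset.sum_mul]
  ring

/-! ### The conditional laws in the prediction step -/

theorem measurable_predictive {E α : Type*} [MeasurableSpace E] [MeasurableSpace α]
    {n k : ℕ} (PΦ : Measure (Config E)) (H : Measure ℝ≥0) [IsProbabilityMeasure H]
    (P₀ : Measure E) [SFinite P₀] (Q : Kernel (Fin k → E) (Config E)) [IsMarkovKernel Q]
    (Q' : Kernel (Fin (k + 1) → E) (Config E)) [IsMarkovKernel Q'] (σ : Fin n → Fin k)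
    {X : α → Fin k → E} (hX : Measurable X) {U : α → ℝ} (hU : Measurable U) :
    Measurable fun a => predictive PΦ H P₀ Q Q' σ (X a) (U a) := by
  refine Measure.measurable_of_measurable_coe _ fun C hC => ?_
  simp only [← lintegral_indicator_one hC]
  exact measurable_lintegral_predictive PΦ H P₀ Q Q' σ hX hU (f := fun p => C.indicator 1 p.2)
    ((measurable_one.indicator hC).comp measurable_snd)

/-- The conditional law of `(Y_{n+1}, U)`: first `U` is drawn with density
`(u / n) f_{U_n | Y}(u)`, then the predictive measure is attached. -/
noncomputable def jointLaw {E : Type*} [MeasurableSpace E] {n k : ℕ} (PΦ : Measure (Config E))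
    (H : Measure ℝ≥0) (P₀ : Measure E) (Q : Kernel (Fin k → E) (Config E))
    (Q' : Kernel (Fin (k + 1) → E) (Config E)) (σ : Fin n → Fin k) (x : Fin k → E) :
    Measure (E × ℝ) :=
  (volume.withDensity fun u => ENNReal.ofReal (u / n) * latentDensity H Q σ x u).bind
    fun u => (predictive PΦ H P₀ Q Q' σ x u).map fun z => (z, u)

theorem lintegral_jointLaw {E : Type*} [MeasurableSpace E] {n k : ℕ} (PΦ : Measure (Config E))
    (H : Measure ℝ≥0) [IsProbabilityMeasure H] (P₀ : Measure E) [SFinite P₀]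
    (Q : Kernel (Fin k → E) (Config E)) [IsMarkovKernel Q]
    (Q' : Kernel (Fin (k + 1) → E) (Config E)) [IsMarkovKernel Q'] (σ : Fin n → Fin k)
    (x : Fin k → E) {f : E × ℝ → ℝ≥0∞} (hf : Measurable f) :
    ∫⁻ p, f p ∂(jointLaw PΦ H P₀ Q Q' σ x)
      = ∫⁻ u, (∫⁻ z, f (z, u) ∂(predictive PΦ H P₀ Q Q' σ x u)) * ENNReal.ofReal (u / n)
          * latentDensity H Q σ x u := by
  have hmap : ∀ u : ℝ, Measurable fun z : E => (z, u) := fun u => measurable_prodMk_right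
  have hK : Measurable fun u => (predictive PΦ H P₀ Q Q' σ x u).map fun z => (z, u) := by
    refine Measure.measurable_of_measurable_coe _ fun C hC => ?_
    have h : ∀ u, ((predictive PΦ H P₀ Q Q' σ x u).map fun z => (z, u)) C
        = ∫⁻ z, C.indicator 1 (z, u) ∂(predictive PΦ H P₀ Q Q' σ x u) := fun u => by
      rw [← lintegral_indicator_one hC, lintegral_map (measurable_one.indicator hC) (hmap u)]
    simp only [h]
    exact measurable_lintegral_predictive PΦ H P₀ Q Q' σ measurable_const measurable_id
      (f := fun p : ℝ × E => C.indicator 1 (p.2, p.1))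
      ((measurable_one.indicator hC).comp measurable_swap)
  have hD : Measurable (latentDensity H Q σ x) := by
    have h := (measurable_latentDensity H Q σ).comp (measurable_prodMk_left (x := x))
    exact h
  have hI : Measurable fun u => ∫⁻ z, f (z, u) ∂(predictive PΦ H P₀ Q Q' σ x u) :=
    measurable_lintegral_predictive PΦ H P₀ Q Q' σ measurable_const measurable_id
      (f := fun p : ℝ × E => f (p.2, p.1)) (hf.comp measurable_swap)
  rw [jointLaw, Measure.lintegral_bind hK.aemeasurable hf.aemeasurable]
  simp only [fun u => lintegral_map (μ := predictive PΦ H P₀ Q Q' σ x u) hf (hmap u)]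
  rw [lintegral_withDensity_eq_lintegral_mul _ (by fun_prop) hI]
  refine lintegral_congr fun u => ?_
  simp only [Pi.mul_apply]
  ring

theorem jointLaw_prod {E : Type*} [MeasurableSpace E] {n k : ℕ} (PΦ : Measure (Config E))
    (H : Measure ℝ≥0) [IsProbabilityMeasure H] (P₀ : Measure E) [SFinite P₀]
    (Q : Kernel (Fin k → E) (Config E)) [IsMarkovKernel Q]
    (Q' : Kernel (Fin (k + 1) → E) (Config E)) [IsMarkovKernel Q'] (σ : Fin n → Fin k)
    (x : Fin k → E) {A : Set E} {B : Set ℝ} (hA : MeasurableSet A) (hB : MeasurableSet B) :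
    jointLaw PΦ H P₀ Q Q' σ x (A ×ˢ B)
      = ∫⁻ u in B, ENNReal.ofReal (u / n) * predictive PΦ H P₀ Q Q' σ x u A
          * latentDensity H Q σ x u := by
  rw [← lintegral_indicator_one (hA.prod hB), lintegral_jointLaw _ _ _ _ _ _ _
    (measurable_one.indicator (hA.prod hB)), ← lintegral_indicator hB]
  refine lintegral_congr fun u => ?_
  have h : ∀ z, (A ×ˢ B).indicator (1 : E × ℝ → ℝ≥0∞) (z, u)
      = B.indicator (fun _ => A.indicator 1 z) u := fun z => by
    by_cases hz : z ∈ A <;> by_cases hu : u ∈ B <;> simp [hz, hu]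
  by_cases hu : u ∈ B
  · simp only [h, hu, Set.indicator_of_mem, lintegral_indicator_one hA]
    ring
  · simp [hu]

/-- The conditional law of `(Y_{n+1}, U)` given the first `n` observations. -/
theorem condDistrib_jointLaw {E : Type*} [MeasurableSpace E] [MeasurableEq E]
    {PΦ : Measure (Config E)} [IsProbabilityMeasure PΦ] (hΦ : ∀ᵐ c ∂PΦ, c.IsSimple)
    (H : Measure ℝ≥0) [IsProbabilityMeasure H] {P₀ : Measure E} [SigmaFinite P₀] {n k : ℕ}
    (hn : 1 ≤ n) {σ : Fin n → Fin k} {s : Fin k → Fin n} (hs : Function.RightInverse s σ)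
    [SigmaFinite (momentMeasure PΦ k)] [SigmaFinite (momentMeasure PΦ (k + 1))]
    (hk : momentMeasure PΦ k ≪ Measure.pi fun _ => P₀)
    (hk' : momentMeasure PΦ (k + 1) ≪ Measure.pi fun _ => P₀)
    {Q : Kernel (Fin k → E) (Config E)} [IsMarkovKernel Q] (hQ : IsReducedPalm PΦ k Q)
    {Q' : Kernel (Fin (k + 1) → E) (Config E)} [IsMarkovKernel Q']
    (hQ' : IsReducedPalm PΦ (k + 1) Q') [StandardBorelSpace E] [Nonempty E] :
    ∀ᵐ ω ∂(sampleLaw PΦ H (n + 1) (n + 1)),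
      (Fin.init ω.1 : Fin n → E) ∈ pattern E σ →
      condDistrib (fun ω => (ω.1 (Fin.last n), ω.2)) (fun ω => Fin.init ω.1)
          (sampleLaw PΦ H (n + 1) (n + 1)) (Fin.init ω.1)
        = jointLaw PΦ H P₀ Q Q' σ ((Fin.init ω.1 : Fin n → E) ∘ s) := by
  have hcomp : Measurable fun y : Fin n → E => y ∘ s := by fun_prop
  refine condDistrib_ae_eq_on (Y := fun ω : (Fin (n + 1) → E) × ℝ => (Fin.init ω.1 : Fin n → E))
    (Z := fun ω => (ω.1 (Fin.last n), ω.2)) (K := fun y => jointLaw PΦ H P₀ Q Q' σ (y ∘ s))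
    ((measurable_init n).comp measurable_fst)
    (((measurable_pi_apply _).comp measurable_fst).prodMk measurable_snd)
    (measurableSet_pattern hs.surjective) ?_ ?_
  · refine Measure.measurable_of_measurable_coe _ fun C hC => ?_
    have hC1 : Measurable (C.indicator (1 : E × ℝ → ℝ≥0∞)) := measurable_one.indicator hC
    simp only [← lintegral_indicator_one hC,
      fun y : Fin n → E => lintegral_jointLaw PΦ H P₀ Q Q' σ (y ∘ s) hC1]
    have h1 : Measurable fun p : (Fin n → E) × ℝ =>
        ∫⁻ z, C.indicator 1 (z, p.2) ∂(predictive PΦ H P₀ Q Q' σ (p.1 ∘ s) p.2) :=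
      measurable_lintegral_predictive PΦ H P₀ Q Q' σ (hcomp.comp measurable_fst) measurable_snd
        (f := fun q : ((Fin n → E) × ℝ) × E => C.indicator 1 (q.2, q.1.2)) (by fun_prop)
    have h2 : Measurable fun p : (Fin n → E) × ℝ => latentDensity H Q σ (p.1 ∘ s) p.2 := by
      have h := (measurable_latentDensity H Q σ).comp
        ((hcomp.comp measurable_fst).prodMk measurable_snd)
      exact h
    have h3 : Measurable fun p : (Fin n → E) × ℝ =>
        (∫⁻ z, C.indicator 1 (z, p.2) ∂(predictive PΦ H P₀ Q Q' σ (p.1 ∘ s) p.2))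
          * ENNReal.ofReal (p.2 / n) * latentDensity H Q σ (p.1 ∘ s) p.2 := by fun_prop
    exact h3.lintegral_prod_right'
  · intro F hF
    rw [map_init_sampleLaw PΦ H hn]
    refine Eq.trans ?_ (setLIntegral_splitLast hΦ H hn hs hk hk' hQ hQ' hF).symm
    exact lintegral_congr fun y => lintegral_jointLaw PΦ H P₀ Q Q' σ (y ∘ s) (by fun_prop)

/-- The integral of this product is the mass of an event under a finite measure. It does not bound
the predictive mass itself where the latent density vanishes. -/
theorem ae_predictive_univ_mul_lt_top {E : Type*} [MeasurableSpace E] [MeasurableEq E]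
    {PΦ : Measure (Config E)} [IsProbabilityMeasure PΦ] (hΦ : ∀ᵐ c ∂PΦ, c.IsSimple)
    (H : Measure ℝ≥0) [IsProbabilityMeasure H] {P₀ : Measure E} [SigmaFinite P₀] {n k : ℕ}
    (hn : 1 ≤ n) {σ : Fin n → Fin k} {s : Fin k → Fin n} (hs : Function.RightInverse s σ)
    [SigmaFinite (momentMeasure PΦ k)] [SigmaFinite (momentMeasure PΦ (k + 1))]
    (hk : momentMeasure PΦ k ≪ Measure.pi fun _ => P₀)
    (hk' : momentMeasure PΦ (k + 1) ≪ Measure.pi fun _ => P₀)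
    {Q : Kernel (Fin k → E) (Config E)} [IsMarkovKernel Q] (hQ : IsReducedPalm PΦ k Q)
    {Q' : Kernel (Fin (k + 1) → E) (Config E)} [IsMarkovKernel Q']
    (hQ' : IsReducedPalm PΦ (k + 1) Q') :
    ∀ᵐ y ∂((sampleLaw PΦ H n n).map Prod.fst).restrict (pattern E σ), ∀ᵐ u : ℝ,
      predictive PΦ H P₀ Q Q' σ (y ∘ s) u Set.univ * ENNReal.ofReal (u / n)
        * latentDensity H Q σ (y ∘ s) u < ∞ := by
  have hcomp : Measurable fun y : Fin n → E => y ∘ s := by fun_prop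
  have h := setLIntegral_splitLast hΦ H hn hs hk hk' hQ hQ' (F := fun _ => 1) measurable_const
  simp only [lintegral_one, Measure.restrict_apply_univ] at h
  have h1 : Measurable fun p : (Fin n → E) × ℝ =>
      predictive PΦ H P₀ Q Q' σ (p.1 ∘ s) p.2 Set.univ :=
    (Measure.measurable_coe .univ).comp
      (measurable_predictive PΦ H P₀ Q Q' σ (hcomp.comp measurable_fst) measurable_snd)
  have h2 : Measurable fun p : (Fin n → E) × ℝ => latentDensity H Q σ (p.1 ∘ s) p.2 := by
    have h := (measurable_latentDensity H Q σ).comp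
      ((hcomp.comp measurable_fst).prodMk measurable_snd)
    exact h
  have h3 : Measurable fun p : (Fin n → E) × ℝ =>
      predictive PΦ H P₀ Q Q' σ (p.1 ∘ s) p.2 Set.univ
        * ENNReal.ofReal (p.2 / n) * latentDensity H Q σ (p.1 ∘ s) p.2 := by fun_prop
  have hfin := h.symm.trans_lt (measure_lt_top (sampleLaw PΦ H (n + 1) (n + 1)) _)
  filter_upwards [ae_lt_top h3.lintegral_prod_right' hfin.ne] with y hy
  have h3y : Measurable fun u : ℝ => predictive PΦ H P₀ Q Q' σ (y ∘ s) u Set.univ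
        * ENNReal.ofReal (u / n) * latentDensity H Q σ (y ∘ s) u := by
    have h := h3.comp (measurable_prodMk_left (x := y))
    exact h
  exact ae_lt_top h3y hy.ne

/-- The joint law is tested on the set `D` of pairs `(y, u)` whose predictive mass is `0` or `∞`.
The integrand there is that mass times a weight: it is zero in the first case, and in the second its
finiteness forces the weight to be zero. Hence `D` is never observed. -/
theorem ae_predictive_univ_ne {E : Type*} [MeasurableSpace E] [MeasurableEq E]
    {PΦ : Measure (Config E)} [IsProbabilityMeasure PΦ] (hΦ : ∀ᵐ c ∂PΦ, c.IsSimple)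
    (H : Measure ℝ≥0) [IsProbabilityMeasure H] {P₀ : Measure E} [SigmaFinite P₀] {n k : ℕ}
    (hn : 1 ≤ n) {σ : Fin n → Fin k} {s : Fin k → Fin n} (hs : Function.RightInverse s σ)
    [SigmaFinite (momentMeasure PΦ k)] [SigmaFinite (momentMeasure PΦ (k + 1))]
    (hk : momentMeasure PΦ k ≪ Measure.pi fun _ => P₀)
    (hk' : momentMeasure PΦ (k + 1) ≪ Measure.pi fun _ => P₀)
    {Q : Kernel (Fin k → E) (Config E)} [IsMarkovKernel Q] (hQ : IsReducedPalm PΦ k Q)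
    {Q' : Kernel (Fin (k + 1) → E) (Config E)} [IsMarkovKernel Q']
    (hQ' : IsReducedPalm PΦ (k + 1) Q') :
    ∀ᵐ ω ∂(sampleLaw PΦ H (n + 1) (n + 1)),
      (Fin.init ω.1 : Fin n → E) ∈ pattern E σ →
      predictive PΦ H P₀ Q Q' σ ((Fin.init ω.1 : Fin n → E) ∘ s) ω.2 Set.univ ≠ 0 ∧
      predictive PΦ H P₀ Q Q' σ ((Fin.init ω.1 : Fin n → E) ∘ s) ω.2 Set.univ ≠ ∞ := by
  have hcomp : Measurable fun y : Fin n → E => y ∘ s := by fun_prop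
  have h1 : Measurable fun p : (Fin n → E) × ℝ =>
      predictive PΦ H P₀ Q Q' σ (p.1 ∘ s) p.2 Set.univ :=
    (Measure.measurable_coe .univ).comp
      (measurable_predictive PΦ H P₀ Q Q' σ (hcomp.comp measurable_fst) measurable_snd)
  have hD : MeasurableSet {p : (Fin n → E) × ℝ |
      predictive PΦ H P₀ Q Q' σ (p.1 ∘ s) p.2 Set.univ ∈ ({0, ∞} : Set ℝ≥0∞)} :=
    h1 ((measurableSet_singleton _).insert _)
  set D := {p : (Fin n → E) × ℝ |
      predictive PΦ H P₀ Q Q' σ (p.1 ∘ s) p.2 Set.univ ∈ ({0, ∞} : Set ℝ≥0∞)} with hDdef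
  have hG : Measurable fun q : (Fin n → E) × (E × ℝ) =>
      D.indicator (1 : (Fin n → E) × ℝ → ℝ≥0∞) (q.1, q.2.2) :=
    (measurable_one.indicator hD).comp
      (measurable_fst.prodMk (measurable_snd.comp measurable_snd))
  have hS : MeasurableSet ((fun p : (Fin (n + 1) → E) × ℝ => (Fin.init p.1 : Fin n → E)) ⁻¹'
      pattern E σ) :=
    ((measurable_init n).comp measurable_fst) (measurableSet_pattern hs.surjective)
  have h := setLIntegral_splitLast hΦ H hn hs hk hk' hQ hQ' hG
  have hz : ∫⁻ y in pattern E σ, (∫⁻ u, (∫⁻ _, D.indicator 1 (y, u)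
        ∂(predictive PΦ H P₀ Q Q' σ (y ∘ s) u)) * ENNReal.ofReal (u / n)
          * latentDensity H Q σ (y ∘ s) u) ∂((sampleLaw PΦ H n n).map Prod.fst) = 0 := by
    refine (lintegral_congr_ae ?_).trans lintegral_zero
    filter_upwards [ae_predictive_univ_mul_lt_top hΦ H hn hs hk hk' hQ hQ'] with y hy
    refine (lintegral_congr_ae ?_).trans lintegral_zero
    filter_upwards [hy] with u hu
    by_cases hD' : (y, u) ∈ D
    · rw [Set.indicator_of_mem hD', Pi.one_apply, lintegral_one]
      rcases hD' with h0 | h0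
      · simp only at h0
        simp [h0]
      · simp only [Set.mem_singleton_iff] at h0
        rw [h0, mul_assoc] at hu ⊢
        by_contra hne
        exact hu.ne (ENNReal.top_mul (right_ne_zero_of_mul hne))
    · simp [Set.indicator_of_notMem hD']
  have hG' : Measurable fun p : (Fin (n + 1) → E) × ℝ =>
      D.indicator (1 : (Fin n → E) × ℝ → ℝ≥0∞) ((splitLast p).1, (splitLast p).2.2) :=
    hG.comp measurable_splitLast
  rw [hz, lintegral_eq_zero_iff hG'] at h
  filter_upwards [(ae_restrict_iff' hS).1 h] with ω hω hωS
  have h0 := hω hωS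
  have : ((Fin.init ω.1 : Fin n → E), ω.2) ∉ D := fun hmem => by
    simp [splitLast, Set.indicator_of_mem hmem] at h0
  simp only [hDdef, Set.mem_ofPred_eq, Set.mem_insert_iff, Set.mem_singleton_iff, not_or] at this
  exact this

/-- The conditional law of `Y_{n+1}` given the first `n` observations and `U`. -/
theorem condDistrib_predictive {E : Type*} [MeasurableSpace E] [MeasurableEq E]
    {PΦ : Measure (Config E)} [IsProbabilityMeasure PΦ] (hΦ : ∀ᵐ c ∂PΦ, c.IsSimple)
    (H : Measure ℝ≥0) [IsProbabilityMeasure H] {P₀ : Measure E} [SigmaFinite P₀] {n k : ℕ}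
    (hn : 1 ≤ n) {σ : Fin n → Fin k} {s : Fin k → Fin n} (hs : Function.RightInverse s σ)
    [SigmaFinite (momentMeasure PΦ k)] [SigmaFinite (momentMeasure PΦ (k + 1))]
    (hk : momentMeasure PΦ k ≪ Measure.pi fun _ => P₀)
    (hk' : momentMeasure PΦ (k + 1) ≪ Measure.pi fun _ => P₀)
    {Q : Kernel (Fin k → E) (Config E)} [IsMarkovKernel Q] (hQ : IsReducedPalm PΦ k Q)
    {Q' : Kernel (Fin (k + 1) → E) (Config E)} [IsMarkovKernel Q']
    (hQ' : IsReducedPalm PΦ (k + 1) Q') [StandardBorelSpace E] [Nonempty E] :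
    ∀ᵐ ω ∂(sampleLaw PΦ H (n + 1) (n + 1)),
      (Fin.init ω.1 : Fin n → E) ∈ pattern E σ →
      condDistrib (fun ω => ω.1 (Fin.last n)) (fun ω => ((Fin.init ω.1 : Fin n → E), ω.2))
          (sampleLaw PΦ H (n + 1) (n + 1)) (Fin.init ω.1, ω.2)
        = (predictive PΦ H P₀ Q Q' σ ((Fin.init ω.1 : Fin n → E) ∘ s) ω.2 Set.univ)⁻¹ •
            predictive PΦ H P₀ Q Q' σ ((Fin.init ω.1 : Fin n → E) ∘ s) ω.2 := by
  have hcomp : Measurable fun y : Fin n → E => y ∘ s := by fun_prop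
  have hN : Measurable fun p : (Fin n → E) × ℝ => predictive PΦ H P₀ Q Q' σ (p.1 ∘ s) p.2 :=
    measurable_predictive PΦ H P₀ Q Q' σ (hcomp.comp measurable_fst) measurable_snd
  have hS := measurableSet_pattern (E := E) hs.surjective
  have hY : Measurable fun ω : (Fin (n + 1) → E) × ℝ => ((Fin.init ω.1 : Fin n → E), ω.2) :=
    ((measurable_init n).comp measurable_fst).prodMk measurable_snd
  have key := condDistrib_ae_eq_on (μ := sampleLaw PΦ H (n + 1) (n + 1))
    (Y := fun ω : (Fin (n + 1) → E) × ℝ => ((Fin.init ω.1 : Fin n → E), ω.2))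
    (Z := fun ω => ω.1 (Fin.last n)) (S := pattern E σ ×ˢ Set.univ)
    (K := fun p => (predictive PΦ H P₀ Q Q' σ (p.1 ∘ s) p.2 Set.univ)⁻¹ •
      predictive PΦ H P₀ Q Q' σ (p.1 ∘ s) p.2)
    hY ((measurable_pi_apply _).comp measurable_fst) (hS.prod .univ) ?_ ?_
  · filter_upwards [key] with ω hω hωS
    exact hω ⟨hωS, trivial⟩
  · refine Measure.measurable_of_measurable_coe _ fun C hC => ?_
    simp only [Measure.smul_apply, smul_eq_mul]
    exact ((Measure.measurable_coe .univ).comp hN).inv.mul ((Measure.measurable_coe hC).comp hN)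
  · intro F hF
    have hI : Measurable fun p : (Fin n → E) × ℝ =>
        ∫⁻ z, F (p, z) ∂(predictive PΦ H P₀ Q Q' σ (p.1 ∘ s) p.2) :=
      measurable_lintegral_predictive PΦ H P₀ Q Q' σ (hcomp.comp measurable_fst) measurable_snd hF
    have hu : Measurable fun p : (Fin n → E) × ℝ =>
        predictive PΦ H P₀ Q Q' σ (p.1 ∘ s) p.2 Set.univ := (Measure.measurable_coe .univ).comp hN
    have hG : Measurable fun p : (Fin n → E) × ℝ =>
        (predictive PΦ H P₀ Q Q' σ (p.1 ∘ s) p.2 Set.univ)⁻¹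
          * ∫⁻ z, F (p, z) ∂(predictive PΦ H P₀ Q Q' σ (p.1 ∘ s) p.2) := hu.inv.mul hI
    have hpre : (fun ω : (Fin (n + 1) → E) × ℝ => ((Fin.init ω.1 : Fin n → E), ω.2)) ⁻¹'
        (pattern E σ ×ˢ Set.univ) = (fun ω => Fin.init ω.1) ⁻¹' pattern E σ := by
      ext; simp
    have hG' : Measurable fun q : (Fin n → E) × (E × ℝ) =>
        (predictive PΦ H P₀ Q Q' σ (q.1 ∘ s) q.2.2 Set.univ)⁻¹
          * ∫⁻ z, F ((q.1, q.2.2), z) ∂(predictive PΦ H P₀ Q Q' σ (q.1 ∘ s) q.2.2) := by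
      have hq : Measurable fun q : (Fin n → E) × (E × ℝ) => (q.1, q.2.2) := by fun_prop
      have h := hG.comp hq
      exact h
    have h1 := setLIntegral_splitLast hΦ H hn hs hk hk' hQ hQ'
      (F := fun q => F ((q.1, q.2.2), q.2.1)) (by fun_prop)
    -- The function in `hG'` does not depend on the new value, so integrating it against the
    -- predictive measure yields the total mass, which cancels the normalizing inverse.
    have h2 := setLIntegral_splitLast hΦ H hn hs hk hk' hQ hQ' hG'
    simp only [lintegral_smul_measure, smul_eq_mul]
    rw [setLIntegral_map (hS.prod .univ) hG hY, hpre]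
    refine h2.trans (Eq.trans ?_ h1.symm)
    refine lintegral_congr_ae ?_
    filter_upwards [ae_predictive_univ_mul_lt_top hΦ H hn hs hk hk' hQ hQ'] with y hy
    refine lintegral_congr_ae ?_
    filter_upwards [hy] with u hu
    simp only [lintegral_const]
    rw [mul_assoc] at hu
    rw [mul_assoc _ (ENNReal.ofReal _), mul_assoc _ (ENNReal.ofReal _)]
    -- The cancellation fails only for mass `0` or `∞`. In the first case the predictive measure is
    -- zero, in the second the weight is zero, and both sides vanish.
    rcases eq_or_ne (predictive PΦ H P₀ Q Q' σ (y ∘ s) u Set.univ) 0 with h0 | h0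
    · rw [Measure.measure_univ_eq_zero.1 h0]
      simp
    rcases eq_or_ne (predictive PΦ H P₀ Q Q' σ (y ∘ s) u Set.univ) ∞ with hT | hT
    · have hw : ENNReal.ofReal (u / n) * latentDensity H Q σ (y ∘ s) u = 0 := by
        by_contra hne
        rw [hT, ENNReal.top_mul hne] at hu
        exact hu.ne rfl
      rw [hw, mul_zero, mul_zero]
    · rw [mul_right_comm _ (lintegral _ _), ENNReal.inv_mul_cancel h0 hT, one_mul]

/-! ### Old and new values -/

theorem newPart_singleton {E : Type*} [MeasurableSpace E] {k : ℕ} (PΦ : Measure (Config E))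
    (H : Measure ℝ≥0) (P₀ : Measure E) [NullSingletonClass P₀] (Q : Kernel (Fin k → E) (Config E))
    (Q' : Kernel (Fin (k + 1) → E) (Config E)) (x : Fin k → E) (u : ℝ) (y : E) :
    newPart PΦ H P₀ Q Q' x u {y} = 0 :=
  withDensity_absolutelyContinuous _ _ (measure_singleton y)

theorem predictive_singleton {E : Type*} [MeasurableSpace E] [MeasurableSingletonClass E]
    {n k : ℕ} (PΦ : Measure (Config E))
    (H : Measure ℝ≥0) (P₀ : Measure E) [NullSingletonClass P₀] (Q : Kernel (Fin k → E) (Config E))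
    (Q' : Kernel (Fin (k + 1) → E) (Config E)) (σ : Fin n → Fin k) {x : Fin k → E}
    (hx : Function.Injective x) (u : ℝ) (j : Fin k) :
    predictive PΦ H P₀ Q Q' σ x u {x j} = oldWeight H σ u j := by
  rw [predictive, Measure.add_apply, newPart_singleton, add_zero, Measure.finsetSum_apply,
    Finset.sum_eq_single j]
  · simp
  · intro i _ hij
    simp [hx.ne hij]
  · simp

theorem predictive_restrict_compl_range {E : Type*} [MeasurableSpace E]
    [MeasurableSingletonClass E] {n k : ℕ} (PΦ : Measure (Config E))
    (H : Measure ℝ≥0) (P₀ : Measure E) [NullSingletonClass P₀] (Q : Kernel (Fin k → E) (Config E))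
    (Q' : Kernel (Fin (k + 1) → E) (Config E)) (σ : Fin n → Fin k) (x : Fin k → E) (u : ℝ) :
    (predictive PΦ H P₀ Q Q' σ x u).restrict (Set.range x)ᶜ = newPart PΦ H P₀ Q Q' x u := by
  have hm : MeasurableSet (Set.range x)ᶜ := (Set.finite_range x).measurableSet.compl
  have hnew : (newPart PΦ H P₀ Q Q' x u).restrict (Set.range x)ᶜ = newPart PΦ H P₀ Q Q' x u := by
    refine Measure.restrict_eq_self_of_ae_mem ?_
    rw [ae_iff]
    simp only [Set.mem_compl_iff, not_not]
    have : {y | y ∈ Set.range x} = ⋃ j, {x j} := by ext; simp [eq_comm]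
    rw [this]
    exact measure_iUnion_null fun j => newPart_singleton ..
  have hold : (∑ j, oldWeight H σ u j • Measure.dirac (x j)).restrict (Set.range x)ᶜ = 0 := by
    rw [Measure.restrict_eq_zero, Measure.finsetSum_apply]
    refine Finset.sum_eq_zero fun j _ => ?_
    simp [hm]
  rw [predictive, Measure.restrict_add, hnew, hold, zero_add]

end NRM

theorem mainTheorem3
    {𝕏 : Type*} [TopologicalSpace 𝕏] [PolishSpace 𝕏] [MeasurableSpace 𝕏] [BorelSpace 𝕏]
    [Nonempty 𝕏]
    -- the law of the finite simple point process and the law of the marks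
    (PΦ : Measure (NRM.Config 𝕏)) [IsProbabilityMeasure PΦ] (hΦ : ∀ᵐ c ∂PΦ, c.IsSimple)
    (H : Measure ℝ≥0) [IsProbabilityMeasure H]
    (P₀ : Measure 𝕏) [IsProbabilityMeasure P₀] [NullSingletonClass P₀]
    -- `n` observations with `k` distinct values; `σ` assigns observations to tables
    {n k : ℕ} (hn : 1 ≤ n) (σ : Fin n → Fin k) (hσ : Function.Surjective σ)
    [SigmaFinite (NRM.momentMeasure PΦ k)] [SigmaFinite (NRM.momentMeasure PΦ (k + 1))]
    (hk : NRM.momentMeasure PΦ k ≪ Measure.pi fun _ => P₀)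
    (hk' : NRM.momentMeasure PΦ (k + 1) ≪ Measure.pi fun _ => P₀)
    -- arbitrary versions of the reduced Palm distributions of orders `k` and `k + 1`
    (Q : Kernel (Fin k → 𝕏) (NRM.Config 𝕏)) [IsMarkovKernel Q]
    (hQ : NRM.IsReducedPalm PΦ k Q)
    (Q' : Kernel (Fin (k + 1) → 𝕏) (NRM.Config 𝕏)) [IsMarkovKernel Q']
    (hQ' : NRM.IsReducedPalm PΦ (k + 1) Q') :
    -- `U_n` given `T` is `Gamma(n, T)`: its conditional law given `Y` has density `f_{U_n | Y}`
    (∀ᵐ ω ∂(NRM.sampleLaw PΦ H n n), ∀ ystar : Fin k → 𝕏, Function.Injective ystar →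
      ω.1 = ystar ∘ σ →
      condDistrib (fun ω => ω.2) (fun ω => ω.1) (NRM.sampleLaw PΦ H n n) ω.1
        = volume.withDensity (NRM.latentDensity H Q σ ystar)) ∧
    -- the sample `Y_1, …, Y_{n+1}` with the auxiliary variable `U` of the prediction step
    (∀ᵐ ω ∂(NRM.sampleLaw PΦ H (n + 1) (n + 1)), ∀ ystar : Fin k → 𝕏,
      Function.Injective ystar → Fin.init ω.1 = ystar ∘ σ →
      -- joint law of `(Y_{n+1}, U)` given `Y`
      (∀ (A : Set 𝕏) (B : Set ℝ), MeasurableSet A → MeasurableSet B →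
        condDistrib (fun ω => (ω.1 (Fin.last n), ω.2)) (fun ω => Fin.init ω.1)
            (NRM.sampleLaw PΦ H (n + 1) (n + 1)) (Fin.init ω.1) (A ×ˢ B)
          = ∫⁻ u in B, ENNReal.ofReal (u / n) * NRM.predictive PΦ H P₀ Q Q' σ ystar u A
              * NRM.latentDensity H Q σ ystar u) ∧
      -- law of `Y_{n+1}` given `Y` and `U`
      NRM.predictive PΦ H P₀ Q Q' σ ystar ω.2 Set.univ ≠ 0 ∧
      NRM.predictive PΦ H P₀ Q Q' σ ystar ω.2 Set.univ ≠ ∞ ∧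
      condDistrib (fun ω => ω.1 (Fin.last n)) (fun ω => (Fin.init ω.1, ω.2))
          (NRM.sampleLaw PΦ H (n + 1) (n + 1)) (Fin.init ω.1, ω.2)
        = (NRM.predictive PΦ H P₀ Q Q' σ ystar ω.2 Set.univ)⁻¹ •
            NRM.predictive PΦ H P₀ Q Q' σ ystar ω.2 ∧
      -- restaurant metaphor: occupied table `j`, respectively a new table and its new dish
      (∀ j, condDistrib (fun ω => ω.1 (Fin.last n)) (fun ω => (Fin.init ω.1, ω.2))
          (NRM.sampleLaw PΦ H (n + 1) (n + 1)) (Fin.init ω.1, ω.2) {ystar j}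
        = NRM.oldWeight H σ ω.2 j / NRM.predictive PΦ H P₀ Q Q' σ ystar ω.2 Set.univ) ∧
      (condDistrib (fun ω => ω.1 (Fin.last n)) (fun ω => (Fin.init ω.1, ω.2))
          (NRM.sampleLaw PΦ H (n + 1) (n + 1)) (Fin.init ω.1, ω.2)).restrict (Set.range ystar)ᶜ
        = (NRM.predictive PΦ H P₀ Q Q' σ ystar ω.2 Set.univ)⁻¹ •
            NRM.newPart PΦ H P₀ Q Q' ystar ω.2) := by
  -- Any admissible `ystar` equals the sample composed with `s`. One null set therefore serves all
  -- `ystar` at once.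
  obtain ⟨s, hs⟩ := hσ.hasRightInverse
  have hcs : ∀ x : Fin k → 𝕏, (x ∘ σ) ∘ s = x := fun x => by ext l; simp [hs l]
  refine ⟨?_, ?_⟩
  · filter_upwards [NRM.condDistrib_latent hΦ H hn hs hQ] with ω hω x hx hy
    rw [hω (hy ▸ NRM.comp_mem_pattern hx), hy, hcs]
  · filter_upwards [NRM.condDistrib_jointLaw hΦ H hn hs hk hk' hQ hQ',
      NRM.ae_predictive_univ_ne hΦ H hn hs hk hk' hQ hQ',
      NRM.condDistrib_predictive hΦ H hn hs hk hk' hQ hQ'] with ω h1 h2 h3 x hx hy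
    have hmem : (Fin.init ω.1 : Fin n → 𝕏) ∈ NRM.pattern 𝕏 σ := hy ▸ NRM.comp_mem_pattern hx
    have hxs : (Fin.init ω.1 : Fin n → 𝕏) ∘ s = x := by rw [hy, hcs]
    have h1' := h1 hmem
    have h2' := h2 hmem
    have h3' := h3 hmem
    rw [hxs] at h1' h2' h3'
    -- The exceptional set does not depend on `A` and `B`, because `h1'` is an equality of measures.
    -- The latent density vanishes off `(0, ∞)`, so the integral may run over all of `B`.
    refine ⟨fun A B hA hB => ?_, h2'.1, h2'.2, h3', fun j => ?_, ?_⟩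
    · rw [h1', NRM.jointLaw_prod PΦ H P₀ Q Q' σ x hA hB]
    · rw [h3', Measure.smul_apply, NRM.predictive_singleton PΦ H P₀ Q Q' σ hx, smul_eq_mul,
        div_eq_mul_inv, mul_comm]
    · rw [h3', Measure.restrict_smul, NRM.predictive_restrict_compl_range]
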